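/- **Setting.** Let $T$ be a finite tree in which every vertex has degree at most $3$. A rooted subtree of $T$ is a directed graph in which exactly one vertex has in-degree $0$ and every other vertex has in-degree $1$, and whose skeleton (the graph obtained by forgetting directions) is a subtree of $T$. Let $\mathcal R$ be a finite multiset of rooted subtrees of $T$, each with at least one edge. Two members *collide* if they share a directed edge. The conflict graph $G_{\mathcal R}$ has the members of $\mathcal R$ as vertices and the colliding pairs as edges, and $\chi(G_{\mathcal R})$ is its chromatic number. A coloring with colors in $\mathbb N$ is valid if colliding members get different colors. A member is present on $\{u,v\}$ if it contains $(u,v)$ or $(v,u)$. For a set $\mathcal S$ of members, $\mathcal S[e]$ is the set of those present on the edge $e$. **GREEDY-COL.** Run a breadth-first search on $T$ from an arbitrary root and let $e_1,\dots,e_m$ be the edges of $T$ in the order of discovery. Start with nothing colored. In round $i$, let $e_i=\{u,v\}$, where $v$ is discovered from $u$, let $\mathcal P$ be the set of members colored so far, with coloring $\psi$, and let $\mathcal Q=\mathcal R[e_i]\setminus\mathcal P$. *First fit* on a set means: while the set has an uncolored member, choose any such member and give it the smallest color not carried by a member that collides with it. The edge $e_i$ is of *type 4* if $u$ has exactly three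 edges $\{u,v\},\{u,w\},\{u,x\}$, of which $\{u,w\}$ is among $e_1,\dots,e_{i-1}$ and $\{u,x\}$ is not. If $e_i$ is not of type 4, apply first fit to $\mathcal Q$. If it is of type 4, run the following two subroutines separately, each starting from $\psi$, and keep the result that uses fewer colors in total (that of the first in case of a tie). For a set $W\subseteq\mathcal P\cup\mathcal Q$, let $H_W$ be the graph on $W$ in which two distinct members are adjacent if they do not collide and neither of the following holds: (a) both are in $\mathcal P$ and have different colors; (b) one of them is some $R\in\mathcal Q$, the other is some $S\in\mathcal P$, and $R$ collides with a $U\in\mathcal P$ with $\psi(U)=\psi(S)$. *PROCESS-EDGE-1.* Take any maximum matching $M$ of $H_W$ for $W=\mathcal P[\{u,v\}]\cup\mathcal Q$. For each edge $\{R,S\}\in M$ with $R\in\mathcal Q$, $S\in\mathcal P$, give $R$ the color of $S$. Then, while $\mathcal Q$ has an uncolored member, choose any such $R$; if $R$ is matched to some $S$ in $M$, give both $R$ and $S$ the smallest color not carried by a member colliding with $R$ or with $S$; otherwise give $R$ the smallest color not carried by a member colliding with $R$. *PROCESS-EDGE-2.* Do the same with $W=(\mathcal P[\{u,x\}]\setminus\mathcal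 P[\{u,v\}])\cup\mathcal Q[\{u,x\}]$, and with $\mathcal Q[\{u,x\}]$ in place of $\mathcal Q$. Then apply first fit to the members of $\mathcal Q$ that are still uncolored. **Theorem.** Whatever choices are made (root and neighbour order of the search, order in which members are chosen, maximum matchings), every execution of some first rounds of GREEDY-COL can be continued with a next round until all edges are processed, and every complete execution outputs a valid coloring of all of $\mathcal R$ that uses at most $\tfrac52\,\chi(G_{\mathcal R})$ colors. -/

import Mathlib

namespace GreedyCol

/-- A rooted subtree of `T`: a subgraph of `T` that is a tree (the skeleton), each of whose edges
is given exactly one direction, such that one vertex has in-degree `0` and every other vertex has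
in-degree `1`. `arc a b` says that `(a, b)` is a directed edge. -/
structure RootedSubtree {V : Type*} (T : SimpleGraph V) where
  skeleton : T.Subgraph
  arc : V → V → Prop
  skeleton_adj : ∀ a b, skeleton.Adj a b ↔ arc a b ∨ arc b a
  arc_asymm : ∀ a b, arc a b → ¬ arc b a
  isTree : skeleton.coe.IsTree
  exists_root : ∃ r ∈ skeleton.verts, (∀ a, ¬ arc a r) ∧
    ∀ b ∈ skeleton.verts, b ≠ r → ∃! a, arc a b

variable {V ι : Type*} {T : SimpleGraph V}

/-- Two rooted subtrees collide if they share a directed edge. -/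
def Collide (A B : RootedSubtree T) : Prop := ∃ a b, A.arc a b ∧ B.arc a b

/-- `A` is present on the undirected edge `{a, b}`, in one of the two directions. -/
def Present (A : RootedSubtree T) (a b : V) : Prop := A.arc a b ∨ A.arc b a

/-- The conflict graph of a finite multiset (indexed family) of rooted subtrees. -/
def conflictGraph (R : ι → RootedSubtree T) : SimpleGraph ι where
  Adj i j := i ≠ j ∧ Collide (R i) (R j)
  symm := ⟨fun _ _ h => ⟨h.1.symm, by
    obtain ⟨a, b, h1, h2⟩ := h.2
    exact ⟨a, b, h2, h1⟩⟩⟩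
  loopless := ⟨fun _ h => h.1 rfl⟩

/-! ### Breadth first search -/

/-- `BFSFrom T q D es`: a breadth first search with queue `q` and set `D` of already discovered
vertices can discover the remaining vertices through the edges `es`, in this order. A pair
`(u, v)` in `es` stands for the edge `{u, v}`, through which `v` is discovered from `u`. The
neighbours of a vertex may be visited in any order. -/
inductive BFSFrom (T : SimpleGraph V) : List V → Set V → List (V × V) → Prop
  | nil (D : Set V) : BFSFrom T [] D []
  | cons (u : V) (q : List V) (D : Set V) (L : List V) (es : List (V × V))
      (hnd : L.Nodup) (hL : ∀ w, w ∈ L ↔ T.Adj u w ∧ w ∉ D)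
      (h : BFSFrom T (q ++ L) (D ∪ {w | w ∈ L}) es) :
      BFSFrom T (u :: q) D (L.map (fun w => (u, w)) ++ es)

/-- `es` lists the edges of `T` in the order of their discovery in a breadth first search from some
root. -/
def IsBFSOrder (T : SimpleGraph V) (es : List (V × V)) : Prop :=
  ∃ r, BFSFrom T [r] {r} es

/-- The undirected edge `{a, b}` is one of the edges listed in `es`. -/
def Processed (es : List (V × V)) (a b : V) : Prop := (a, b) ∈ es ∨ (b, a) ∈ es

/-- The edge `{u, v}`, about to be processed after the edges in `es`, is of type 4: `u` has degree
`3`, its edges are `{u, v}`, `{u, w}`, `{u, x}`, and `{u, w}` has been processed while `{u, x}` has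
not. -/
def IsType4 (T : SimpleGraph V) (es : List (V × V)) (u v w x : V) : Prop :=
  v ≠ w ∧ v ≠ x ∧ w ≠ x ∧ (∀ y, T.Adj u y ↔ y = v ∨ y = w ∨ y = x) ∧
    Processed es u w ∧ ¬ Processed es u x

/-! ### Partial colorings and first fit

A partial coloring is a map `φ : ι → Option ℕ`, where `none` means uncolored. -/

/-- The number of colors that a partial coloring uses. -/
noncomputable def numColors (φ : ι → Option ℕ) : ℕ := {c : ℕ | ∃ i, φ i = some c}.ncard

/-- The smallest color that is carried by no member of the family that collides with member `r` or
with member `s`. -/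
noncomputable def minFree (R : ι → RootedSubtree T) (φ : ι → Option ℕ) (r s : ι) : ℕ :=
  sInf {m : ℕ | ¬ ∃ i, (Collide (R r) (R i) ∨ Collide (R s) (R i)) ∧ φ i = some m}

/-- The members that are present on `{u, v}` and not colored by `φ`. -/
def uncolored (R : ι → RootedSubtree T) (φ : ι → Option ℕ) (u v : V) : Set ι :=
  {i | Present (R i) u v ∧ φ i = none}

/-- The members that are present on `{u, v}` and colored by `φ`. -/
def colored (R : ι → RootedSubtree T) (φ : ι → Option ℕ) (u v : V) : Set ι :=
  {i | Present (R i) u v ∧ φ i ≠ none}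

/-- While there is an uncolored member in `S`, choose any such member and give it the smallest free
color. `FirstFit R S φ φ'` says that this loop can turn `φ` into `φ'`. -/
inductive FirstFit [DecidableEq ι] (R : ι → RootedSubtree T) (S : Set ι) :
    (ι → Option ℕ) → (ι → Option ℕ) → Prop
  | done (φ : ι → Option ℕ) (h : ∀ i ∈ S, φ i ≠ none) : FirstFit R S φ φ
  | step (φ φ' : ι → Option ℕ) (r : ι) (hr : r ∈ S) (hφ : φ r = none)
      (h : FirstFit R S (Function.update φ r (some (minFree R φ r r))) φ') : FirstFit R S φ φ'

/-! ### The two matching subroutines -/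

/-- The condition under which the subroutines forbid an uncolored or colored member `i` and a
member `j` that does not collide with it to share a color (to be symmetrized): both are colored,
with different colors, or `i` is uncolored, `j` is colored, and `i` collides with some member that
has the color of `j`. -/
def Forbidden (R : ι → RootedSubtree T) (φ : ι → Option ℕ) (i j : ι) : Prop :=
  (φ i ≠ none ∧ φ j ≠ none ∧ φ i ≠ φ j) ∨
    (φ i = none ∧ φ j ≠ none ∧ ∃ k, φ k = φ j ∧ Collide (R i) (R k))

/-- The complement, on the vertex set `W`, of the graph whose edges are the colliding pairs and the
forbidden pairs. It is put on all of `ι`, with the vertices outside `W` isolated. -/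
def shareGraph (R : ι → RootedSubtree T) (φ : ι → Option ℕ) (W : Set ι) : SimpleGraph ι where
  Adj i j := i ≠ j ∧ i ∈ W ∧ j ∈ W ∧
    ¬ ((conflictGraph R).Adj i j ∨ Forbidden R φ i j ∨ Forbidden R φ j i)
  symm := ⟨fun i j h => ⟨h.1.symm, h.2.2.1, h.2.1, fun h' => h.2.2.2 (by
    rcases h' with h' | h' | h'
    · exact Or.inl h'.symm
    · exact Or.inr (Or.inr h')
    · exact Or.inr (Or.inl h'))⟩⟩
  loopless := ⟨fun _ h => h.1 rfl⟩

/-- `M` is a matching of `G` with the largest possible number of edges. -/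
def IsMaximumMatching {G : SimpleGraph ι} (M : G.Subgraph) : Prop :=
  M.IsMatching ∧ ∀ M' : G.Subgraph, M'.IsMatching → M'.edgeSet.ncard ≤ M.edgeSet.ncard

/-- For every edge of `M` between an uncolored member and a colored one, the uncolored one takes the
color of the other; nothing else changes. -/
def Transfer {G : SimpleGraph ι} (M : G.Subgraph) (φ φ' : ι → Option ℕ) : Prop :=
  (∀ r s, φ r = none → φ s ≠ none → M.Adj r s → φ' r = φ s) ∧
    ∀ r, ¬ (φ r = none ∧ ∃ s, φ s ≠ none ∧ M.Adj r s) → φ' r = φ r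

/-- While there is an uncolored member in `S`, choose any such member `r`. If `M` matches it to some
`s`, both get the smallest color that is free for both, otherwise `r` gets the smallest color that
is free for it. -/
inductive MatchedFit [DecidableEq ι] (R : ι → RootedSubtree T) {G : SimpleGraph ι}
    (M : G.Subgraph) (S : Set ι) : (ι → Option ℕ) → (ι → Option ℕ) → Prop
  | done (φ : ι → Option ℕ) (h : ∀ i ∈ S, φ i ≠ none) : MatchedFit R M S φ φ
  | pair (φ φ' : ι → Option ℕ) (r s : ι) (hr : r ∈ S) (hφ : φ r = none) (hM : M.Adj r s)
      (h : MatchedFit R M S (Function.update (Function.update φ r (some (minFree R φ r s)))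
        s (some (minFree R φ r s))) φ') : MatchedFit R M S φ φ'
  | single (φ φ' : ι → Option ℕ) (r : ι) (hr : r ∈ S) (hφ : φ r = none) (hM : ∀ s, ¬ M.Adj r s)
      (h : MatchedFit R M S (Function.update φ r (some (minFree R φ r r))) φ') :
      MatchedFit R M S φ φ'

/-- PROCESS-EDGE-1 on the edge `{u, v}` can turn `φ` into `φ'`. -/
def ProcessEdge1 [DecidableEq ι] (R : ι → RootedSubtree T) (u v : V)
    (φ φ' : ι → Option ℕ) : Prop :=
  ∃ (M : (shareGraph R φ (colored R φ u v ∪ uncolored R φ u v)).Subgraph) (φ₁ : ι → Option ℕ),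
    IsMaximumMatching M ∧ Transfer M φ φ₁ ∧ MatchedFit R M (uncolored R φ u v) φ₁ φ'

/-- PROCESS-EDGE-2 on the edge `{u, v}`, with `{u, x}` the other unprocessed edge at `u`, can turn
`φ` into `φ'`. -/
def ProcessEdge2 [DecidableEq ι] (R : ι → RootedSubtree T) (u v x : V)
    (φ φ' : ι → Option ℕ) : Prop :=
  ∃ (M : (shareGraph R φ ((colored R φ u x \ colored R φ u v) ∪
      {i ∈ uncolored R φ u v | Present (R i) u x})).Subgraph) (φ₁ φ₂ : ι → Option ℕ),
    IsMaximumMatching M ∧ Transfer M φ φ₁ ∧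
      MatchedFit R M {i ∈ uncolored R φ u v | Present (R i) u x} φ₁ φ₂ ∧
      FirstFit R (uncolored R φ u v) φ₂ φ'

/-! ### The algorithm -/

/-- One round of GREEDY-COL: the edge `{u, v}` is processed after the edges in `es`. -/
def Round [DecidableEq ι] (R : ι → RootedSubtree T) (es : List (V × V)) (u v : V)
    (φ φ' : ι → Option ℕ) : Prop :=
  (∃ w x, IsType4 T es u v w x ∧ ∃ φ₁ φ₂, ProcessEdge1 R u v φ φ₁ ∧ ProcessEdge2 R u v x φ φ₂ ∧
      φ' = if numColors φ₁ ≤ numColors φ₂ then φ₁ else φ₂) ∨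
    ((¬ ∃ w x, IsType4 T es u v w x) ∧ FirstFit R (uncolored R φ u v) φ φ')

/-- `GreedyColRun R es φ`: starting from the empty coloring, GREEDY-COL can reach the partial
coloring `φ` by processing the edges in `es` in this order. -/
inductive GreedyColRun [DecidableEq ι] (R : ι → RootedSubtree T) :
    List (V × V) → (ι → Option ℕ) → Prop
  | nil : GreedyColRun R [] (fun _ => none)
  | snoc (es : List (V × V)) (u v : V) (φ φ' : ι → Option ℕ) (h : GreedyColRun R es φ)
      (hr : Round R es u v φ φ') : GreedyColRun R (es ++ [(u, v)]) φ'

end GreedyCol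

namespace GreedyCol

/-! ### Counting colors by means of matchings -/

/-! Fix an optimal coloring with $k$ classes. An edge has only two directions, so among three
members present on it two collide. Hence a class has at most two members on any edge, and an edge
carries at most $2k$ members. The invariant `IsState` says that the coloring is valid and that its
colors form an initial segment below $N=\lfloor 5k/2\rfloor$. The discovered vertices span a
subtree, so a new member can collide with an old one only if both are present on a common edge from
$u$ to an undiscovered vertex (`IsState.exists_common_present`). Degree at most $3$ makes this edge
$\{u,v\}$ itself outside type 4, and first fit then stays below $2k$.

In type 4 let $A$ be the colored members on $\{u,v\}$, $B$ the other colored members on $\{u,x\}$,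
and $X$, $Y$ the uncolored members on $\{u,v\}$ that are, respectively are not, on $\{u,x\}$. Then
$A\cup B$ lies on $\{u,w\}$, $B\cup X$ on $\{u,x\}$ and $A\cup X\cup Y$ on $\{u,v\}$, so each class
has at most two members in each of these sets. The matched phases use no color beyond $N$ and the
numbers $n_1$, $n_2$ of colors that they leave on $A\cup B\cup X\cup Y$ and $A\cup B\cup X$. The
last phase of PROCESS-EDGE-2 stays below $2k$. It therefore suffices that $n_1+n_2\le 5k$.

Let $t$ count the members of $A\cup B$ whose color recurs in $A\cup B$ (twins). Every matching edge
saves a color, except those with two colored ends; the latter have at most $t$ ends in both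
matchings together. This gives $n_1+n_2\le 2|A|+2|B|+2|X|+|Y|-|M_1|-|M_2|-t/2$. A class contributes
at most $5$ to the weighted sum, or $6$ if it meets all of $A,B,X$ or has two members in $Y$. Such a
class contains a pair admissible for one of the matchings, or two twins, and this pays for the
excess (`card_image_add_card_image_le`). -/

theorem two_mul_card_image_le {α γ : Type*} [DecidableEq γ] (s : Finset α) (g : α → γ)
    (h : ∀ i ∈ s, ∃ j ∈ s, j ≠ i ∧ g j = g i) : 2 * (s.image g).card ≤ s.card := by
  classical
  refine Finset.mul_card_image_le_card_of_maps_to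
    (fun a ha => Finset.mem_image_of_mem g ha) 2 ?_
  intro b hb
  obtain ⟨i, hi, rfl⟩ := Finset.mem_image.1 hb
  obtain ⟨j, hj, hji, hg⟩ := h i hi
  exact Finset.one_lt_card.2 ⟨j, by simp [hj, hg], i, by simp [hi], hji⟩

/-- A value taken more than once has at least two preimages, so a member with a twin accounts for at
most half a value. -/
theorem two_mul_card_image_add_card_twins_le {α γ : Type*} [DecidableEq α] [DecidableEq γ]
    (P : Finset α) (g : α → γ) :
    2 * (P.image g).card + (P.filter fun i => ∃ j ∈ P, j ≠ i ∧ g j = g i).card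
      ≤ 2 * P.card := by
  set t := P.filter fun i => ∃ j ∈ P, j ≠ i ∧ g j = g i
  set s := P.filter fun i => ¬ ∃ j ∈ P, j ≠ i ∧ g j = g i
  have h1 : t.card + s.card = P.card := Finset.card_filter_add_card_filter_not _
  have h2 : P.image g = t.image g ∪ s.image g := by
    rw [← Finset.image_union, Finset.filter_union_filter_not_eq]
  have h3 : 2 * (t.image g).card ≤ t.card := by
    refine two_mul_card_image_le t g fun i hi => ?_
    obtain ⟨hi, j, hj, hji, hg⟩ := Finset.mem_filter.1 hi
    exact ⟨j, Finset.mem_filter.2 ⟨hj, i, hi, hji.symm, hg.symm⟩, hji, hg⟩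
  have h4 : (s.image g).card ≤ s.card := Finset.card_image_le
  have h5 : (P.image g).card ≤ (t.image g).card + (s.image g).card := by
    rw [h2]; exact Finset.card_union_le _ _
  omega

/-- The number of values of a function that is constant on the orbits of an involution `f`: each
pair of `f` that meets `Q` saves one value. -/
theorem card_image_union_add_card_moved_le {α γ : Type*} [DecidableEq α] [DecidableEq γ]
    {P P' Q : Finset α} (hPP : P' ⊆ P) (hPQ : Disjoint P' Q) (f : α → α) (hf : ∀ i, f (f i) = i)
    (hfW : ∀ i, f i ≠ i → i ∈ P' ∪ Q) (g : α → γ) (hg : ∀ i, g (f i) = g i) :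
    2 * ((P ∪ Q).image g).card + ((P' ∪ Q).filter fun i => f i ≠ i).card ≤
      2 * (P.image g).card + 2 * Q.card + (P'.filter fun i => f i ≠ i ∧ f i ∈ P').card := by
  have hfW' : ∀ i, f i ≠ i → f i ∈ P' ∪ Q := fun i hi => hfW _ (by rw [hf]; exact hi.symm)
  set PP := P'.filter fun i => f i ≠ i ∧ f i ∈ P'
  set PQ := P'.filter fun i => f i ≠ i ∧ f i ∈ Q
  set QP := Q.filter fun i => f i ≠ i ∧ f i ∈ P'
  set QQ := Q.filter fun i => f i ≠ i ∧ f i ∈ Q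
  set Q0 := Q.filter fun i => f i = i
  have hd : ∀ i, i ∈ P' → i ∉ Q := fun i h1 h2 => Finset.disjoint_left.1 hPQ h1 h2
  have e1 : PQ.card = QP.card := by
    refine Finset.card_bij (fun i _ => f i) ?_ ?_ ?_
    · intro i hi
      obtain ⟨h1, h2, h3⟩ := Finset.mem_filter.1 hi
      exact Finset.mem_filter.2 ⟨h3, by rw [hf]; exact h2.symm, by rw [hf]; exact h1⟩
    · intro i _ j _ h
      rw [← hf i, ← hf j]
      exact congrArg f h
    · intro i hi
      obtain ⟨h1, h2, h3⟩ := Finset.mem_filter.1 hi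
      exact ⟨f i, Finset.mem_filter.2 ⟨h3, by rw [hf]; exact h2.symm, by rw [hf]; exact h1⟩, hf i⟩
  have e2 : ((P' ∪ Q).filter fun i => f i ≠ i).card ≤ PP.card + PQ.card + (QP.card + QQ.card) := by
    have : ((P' ∪ Q).filter fun i => f i ≠ i) ⊆ (PP ∪ PQ) ∪ (QP ∪ QQ) := by
      intro i hi
      have h1 := (Finset.mem_filter.1 hi).2
      have h2 := Finset.mem_union.1 (Finset.mem_filter.1 hi).1
      have h3 := Finset.mem_union.1 (hfW' i h1)
      simp only [PP, PQ, QP, QQ, Finset.mem_union, Finset.mem_filter]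
      tauto
    refine (Finset.card_le_card this).trans ((Finset.card_union_le _ _).trans ?_)
    exact add_le_add (Finset.card_union_le _ _) (Finset.card_union_le _ _)
  have e3 : Q0.card + (QP.card + QQ.card) ≤ Q.card := by
    have d1 : Disjoint QP QQ := Finset.disjoint_filter.2 fun i _ h1 h2 => hd _ h1.2 h2.2
    have d2 : Disjoint Q0 (QP ∪ QQ) := by
      rw [Finset.disjoint_union_right]
      exact ⟨Finset.disjoint_filter.2 fun i _ h1 h2 => h2.1 h1,
        Finset.disjoint_filter.2 fun i _ h1 h2 => h2.1 h1⟩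
    rw [← Finset.card_union_of_disjoint d1, ← Finset.card_union_of_disjoint d2]
    refine Finset.card_le_card (Finset.union_subset (Finset.filter_subset _ _)
      (Finset.union_subset (Finset.filter_subset _ _) (Finset.filter_subset _ _)))
  have e4 : 2 * (QQ.image g).card ≤ QQ.card := by
    refine two_mul_card_image_le QQ g fun i hi => ?_
    obtain ⟨h1, h2, h3⟩ := Finset.mem_filter.1 hi
    exact ⟨f i, Finset.mem_filter.2 ⟨h3, by rw [hf]; exact h2.symm, by rw [hf]; exact h1⟩, h2, hg i⟩
  -- Values outside `P.image g` come only from fixed members of `Q` and from pairs inside `Q`; a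
  -- member of `Q` paired with `P'` repeats a value of `P`.
  have e5 : ((P ∪ Q).image g).card ≤ (P.image g).card + (Q0.card + (QQ.image g).card) := by
    have : (P ∪ Q).image g ⊆ P.image g ∪ (Q0.image g ∪ QQ.image g) := by
      intro c hc
      obtain ⟨i, hi, rfl⟩ := Finset.mem_image.1 hc
      rcases Finset.mem_union.1 hi with hi | hi
      · exact Finset.mem_union_left _ (Finset.mem_image_of_mem g hi)
      · by_cases h : f i = i
        · exact Finset.mem_union_right _ (Finset.mem_union_left _
            (Finset.mem_image_of_mem g (Finset.mem_filter.2 ⟨hi, h⟩)))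
        · rcases Finset.mem_union.1 (hfW' i h) with h' | h'
          · refine Finset.mem_union_left _ (Finset.mem_image.2 ⟨f i, hPP h', hg i⟩)
          · exact Finset.mem_union_right _ (Finset.mem_union_right _
              (Finset.mem_image_of_mem g (Finset.mem_filter.2 ⟨hi, h, h'⟩)))
    refine (Finset.card_le_card this).trans ((Finset.card_union_le _ _).trans ?_)
    exact Nat.add_le_add_left ((Finset.card_union_le _ _).trans
      (Nat.add_le_add_right Finset.card_image_le _)) _
  omega

/-! ### Matchings -/

theorem adj_right_unique {ι : Type*} {G : SimpleGraph ι} {M : G.Subgraph} (hM : M.IsMatching)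
    {r s t : ι} (h1 : M.Adj r s) (h2 : M.Adj r t) : s = t :=
  (hM (M.edge_vert h1)).unique h1 h2

/-- The involution that exchanges the ends of every edge of a matching. -/
theorem exists_involution_of_isMatching {ι : Type*} {G : SimpleGraph ι} {M : G.Subgraph}
    (hM : M.IsMatching) : ∃ f : ι → ι, (∀ i, f (f i) = i) ∧ (∀ i, f i ≠ i → M.Adj i (f i)) ∧
      ∀ i j, M.Adj i j → f i = j := by
  classical
  have key : ∀ i, ∃ j, (M.Adj i j ∨ (j = i ∧ ∀ s, ¬ M.Adj i s)) := fun i => by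
    by_cases h : ∃ s, M.Adj i s
    · exact ⟨h.choose, Or.inl h.choose_spec⟩
    · exact ⟨i, Or.inr ⟨rfl, fun s hs => h ⟨s, hs⟩⟩⟩
  choose f hf using key
  have hadj : ∀ i j, M.Adj i j → f i = j := fun i j hij => by
    rcases hf i with h | h
    · exact adj_right_unique hM h hij
    · exact absurd hij (h.2 j)
  refine ⟨f, fun i => ?_, fun i hi => ?_, hadj⟩
  · rcases hf i with h | h
    · exact hadj _ _ h.symm
    · rw [h.1, h.1]
  · rcases hf i with h | h
    · exact h
    · exact absurd h.1 hi

/-- Both ends of an edge are moved by `f`. This turns the size of a matching into the count of moved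
members in `card_image_union_add_card_moved_le`. -/
theorem two_mul_ncard_edgeSet_le {ι : Type*} [Finite ι] [DecidableEq ι] {G : SimpleGraph ι}
    {M : G.Subgraph} {f : ι → ι} (hf : ∀ i, f (f i) = i) (hM : ∀ i j, M.Adj i j → f i = j)
    {W : Finset ι} (hW : ∀ i, f i ≠ i → i ∈ W) :
    2 * M.edgeSet.ncard ≤ (W.filter fun i => f i ≠ i).card := by
  classical
  set s := W.filter fun i => f i ≠ i
  have h1 : M.edgeSet ⊆ (s.image fun i => s(i, f i) : Finset (Sym2 ι)) := by
    intro e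
    induction e using Sym2.ind with
    | _ a b =>
      intro h
      have h : M.Adj a b := h
      have hab : f a ≠ a := by rw [hM _ _ h]; exact h.ne.symm
      rw [Finset.mem_coe, Finset.mem_image]
      exact ⟨a, Finset.mem_filter.2 ⟨hW _ hab, hab⟩, by rw [hM _ _ h]⟩
  have h2 := Set.ncard_le_ncard h1 (Finset.finite_toSet _)
  rw [Set.ncard_coe_finset] at h2
  have h3 : 2 * (s.image fun i => s(i, f i)).card ≤ s.card := by
    refine Finset.mul_card_image_le_card_of_maps_to
      (fun a ha => Finset.mem_image_of_mem _ ha) 2 ?_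
    intro b hb
    obtain ⟨i, hi, rfl⟩ := Finset.mem_image.1 hb
    have hi' := Finset.mem_filter.1 hi
    have hfi : f (f i) ≠ f i := by rw [hf]; exact hi'.2.symm
    exact Finset.one_lt_card.2 ⟨i, Finset.mem_filter.2 ⟨hi, rfl⟩, f i, Finset.mem_filter.2
      ⟨Finset.mem_filter.2 ⟨hW _ hfi, hfi⟩, by rw [hf, Sym2.eq_swap]⟩, hi'.2.symm⟩
  omega

/-- A family of disjoint edges is no larger than a maximum matching. -/
theorem card_le_ncard_edgeSet {ι κ : Type*} [Finite ι] {G : SimpleGraph ι}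
    {M : G.Subgraph} (hM : IsMaximumMatching M) (C : Finset κ) (a b : κ → ι) (o : ι → κ)
    (hG : ∀ c ∈ C, G.Adj (a c) (b c)) (ha : ∀ c ∈ C, o (a c) = c) (hb : ∀ c ∈ C, o (b c) = c) :
    C.card ≤ M.edgeSet.ncard := by
  classical
  -- The edges form a matching: `o` recovers the index of an edge from either of its ends.
  let N : G.Subgraph :=
    { verts := {i | ∃ c ∈ C, i = a c ∨ i = b c}
      Adj := fun i j => ∃ c ∈ C, (i = a c ∧ j = b c) ∨ (i = b c ∧ j = a c)
      adj_sub := by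
        rintro i j ⟨c, hc, ⟨rfl, rfl⟩ | ⟨rfl, rfl⟩⟩
        · exact hG c hc
        · exact (hG c hc).symm
      edge_vert := by
        rintro i j ⟨c, hc, ⟨rfl, rfl⟩ | ⟨rfl, rfl⟩⟩
        · exact ⟨c, hc, Or.inl rfl⟩
        · exact ⟨c, hc, Or.inr rfl⟩
      symm := ⟨by
        rintro i j ⟨c, hc, h | h⟩
        · exact ⟨c, hc, Or.inr ⟨h.2, h.1⟩⟩
        · exact ⟨c, hc, Or.inl ⟨h.2, h.1⟩⟩⟩ }
  have hN : N.IsMatching := by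
    rintro i ⟨c, hc, rfl | rfl⟩
    · refine ⟨b c, ⟨c, hc, Or.inl ⟨rfl, rfl⟩⟩, ?_⟩
      rintro j ⟨d, hd, ⟨h1, rfl⟩ | ⟨h1, rfl⟩⟩
      · have : c = d := by rw [← ha c hc, h1, ha d hd]
        rw [this]
      · have : c = d := by rw [← ha c hc, h1, hb d hd]
        subst this
        exact absurd h1 (hG c hc).ne
    · refine ⟨a c, ⟨c, hc, Or.inr ⟨rfl, rfl⟩⟩, ?_⟩
      rintro j ⟨d, hd, ⟨h1, rfl⟩ | ⟨h1, rfl⟩⟩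
      · have : c = d := by rw [← hb c hc, h1, ha d hd]
        subst this
        exact absurd h1.symm (hG c hc).ne
      · have : c = d := by rw [← hb c hc, h1, hb d hd]
        rw [this]
  refine le_trans ?_ (hM.2 N hN)
  rw [← Set.ncard_coe_finset]
  refine Set.ncard_le_ncard_of_injOn (fun c => s(a c, b c)) ?_ ?_ (Set.toFinite _)
  · intro c hc
    exact ⟨c, hc, Or.inl ⟨rfl, rfl⟩⟩
  · intro c hc d hd h
    rcases Sym2.eq_iff.1 h with h | h
    · rw [← ha c hc, h.1, ha d hd]
    · rw [← ha c hc, h.1, hb d hd]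

/-- If every class of `o` meets three unions of the sets `A`, `B`, `X`, `Y` in at most two members,
then `A`, `B`, `X` count twice and `Y` once for at most `5` per class, up to an excess of `1` for
the exceptional classes in `E`. -/
theorem weighted_card_le {ι κ : Type*} [DecidableEq ι] [Fintype κ] [DecidableEq κ] (o : ι → κ)
    (A B X Y : Finset ι) (E : Finset κ)
    (h1 : ∀ c, (A.filter fun i => o i = c).card + (B.filter fun i => o i = c).card ≤ 2)
    (h2 : ∀ c, (B.filter fun i => o i = c).card + (X.filter fun i => o i = c).card ≤ 2)
    (h3 : ∀ c, (A.filter fun i => o i = c).card + ((X.filter fun i => o i = c).card +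
      (Y.filter fun i => o i = c).card) ≤ 2)
    (hE : ∀ c, (0 < (A.filter fun i => o i = c).card ∧ 0 < (B.filter fun i => o i = c).card ∧
      0 < (X.filter fun i => o i = c).card) ∨ 1 < (Y.filter fun i => o i = c).card → c ∈ E) :
    2 * A.card + 2 * B.card + 2 * X.card + Y.card ≤ 5 * Fintype.card κ + E.card := by
  have hs : ∀ S : Finset ι, S.card = ∑ c : κ, (S.filter fun i => o i = c).card := fun S =>
    Finset.card_eq_sum_card_fiberwise fun i _ => Finset.mem_coe.2 (Finset.mem_univ _)
  have hE' : E.card = ∑ c : κ, if c ∈ E then 1 else 0 := by simp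
  have hk : 5 * Fintype.card κ = ∑ _c : κ, 5 := by simp [mul_comm]
  rw [hs A, hs B, hs X, hs Y, hE', hk]
  simp only [Finset.mul_sum, ← Finset.sum_add_distrib]
  refine Finset.sum_le_sum fun c _ => ?_
  have := h1 c
  have := h2 c
  have := h3 c
  have := hE c
  -- With class sizes $a,b,x,y$, the sum $2a+2b+2x+y$ is at most $6$, with equality only for
  -- $a=b=x=1$, $y=0$ and for $b=y=2$, $a=x=0$.
  split_ifs with hc
  · omega
  · have : ¬ _ := fun h => hc (hE c h)
    omega

/-! ### Admissible pairs and the joint bound for the two subroutines -/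

variable {V ι : Type*} {T : SimpleGraph V}

theorem Collide.symm {A B : RootedSubtree T} (h : Collide A B) : Collide B A := by
  obtain ⟨a, b, h1, h2⟩ := h
  exact ⟨a, b, h2, h1⟩

theorem eq_of_shareGraph_adj {R : ι → RootedSubtree T} {φ : ι → Option ℕ} {W : Set ι} {i j : ι}
    (h : (shareGraph R φ W).Adj i j) (hi : φ i ≠ none) (hj : φ j ≠ none) : φ i = φ j := by
  by_contra hij
  exact h.2.2.2 (Or.inr (Or.inl (Or.inl ⟨hi, hj, hij⟩)))

theorem not_collide_of_shareGraph_adj {R : ι → RootedSubtree T} {φ : ι → Option ℕ} {W : Set ι}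
    {i j : ι} (h : (shareGraph R φ W).Adj i j) : ¬ Collide (R i) (R j) :=
  fun hc => h.2.2.2 (Or.inl ⟨h.1, hc⟩)

/-- An uncolored and a colored member that do not collide may share a color, unless a second member
of that color collides with the first. -/
theorem shareGraph_adj_or_exists {R : ι → RootedSubtree T} {φ : ι → Option ℕ} {W : Set ι}
    {r s : ι} (hr : r ∈ W) (hs : s ∈ W) (hφr : φ r = none) (hφs : φ s ≠ none)
    (hrs : ¬ Collide (R r) (R s)) : (shareGraph R φ W).Adj r s ∨
      ∃ k, k ≠ s ∧ φ k = φ s ∧ Collide (R r) (R k) := by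
  by_cases h : ∃ k, φ k = φ s ∧ Collide (R r) (R k)
  · obtain ⟨k, h1, h2⟩ := h
    refine Or.inr ⟨k, ?_, h1, h2⟩
    rintro rfl
    exact hrs h2
  · refine Or.inl ⟨?_, hr, hs, ?_⟩
    · rintro rfl
      exact hφs hφr
    · rintro (h' | (h' | h') | (h' | h'))
      · exact hrs h'.2
      · exact h'.1 hφr
      · exact h h'.2.2
      · exact h'.2.1 hφr
      · exact hφs h'.1

/-- The two subroutines together produce at most five times as many colors as there are classes in
a proper coloring `o`. -/
theorem card_image_add_card_image_le [Finite ι] [DecidableEq ι] {κ : Type*} [Fintype κ]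
    [DecidableEq κ]
    (R : ι → RootedSubtree T) (φ : ι → Option ℕ) (o : ι → κ)
    (ho : ∀ i j, i ≠ j → o i = o j → ¬ Collide (R i) (R j)) {A B X Y : Finset ι}
    (hA : ∀ i ∈ A, φ i ≠ none) (hB : ∀ i ∈ B, φ i ≠ none) (hX : ∀ i ∈ X, φ i = none)
    (hY : ∀ i ∈ Y, φ i = none) (hAB : Disjoint A B) (hXY : Disjoint X Y)
    (hcol : ∀ i ∈ X, ∀ j, φ j ≠ none → Collide (R i) (R j) → j ∈ A ∪ B)
    (h1 : ∀ c, ((A ∪ B).filter fun i => o i = c).card ≤ 2)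
    (h2 : ∀ c, ((B ∪ X).filter fun i => o i = c).card ≤ 2)
    (h3 : ∀ c, ((A ∪ (X ∪ Y)).filter fun i => o i = c).card ≤ 2)
    {W₁ W₂ : Set ι} (hW₁ : ∀ i, i ∈ W₁ ↔ i ∈ A ∪ (X ∪ Y)) (hW₂ : ∀ i, i ∈ W₂ ↔ i ∈ B ∪ X)
    {M₁ : (shareGraph R φ W₁).Subgraph} {M₂ : (shareGraph R φ W₂).Subgraph}
    (hM₁ : IsMaximumMatching M₁) (hM₂ : IsMaximumMatching M₂) {g₁ g₂ : ι → Option ℕ}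
    (hg₁ : ∀ i, φ i ≠ none → g₁ i = φ i) (hg₂ : ∀ i, φ i ≠ none → g₂ i = φ i)
    (hgM₁ : ∀ i j, M₁.Adj i j → g₁ i = g₁ j) (hgM₂ : ∀ i j, M₂.Adj i j → g₂ i = g₂ j) :
    ((A ∪ B ∪ (X ∪ Y)).image g₁).card + ((A ∪ B ∪ X).image g₂).card ≤ 5 * Fintype.card κ := by
  classical
  have hP : ∀ i ∈ A ∪ B, φ i ≠ none := fun i hi => (Finset.mem_union.1 hi).elim (hA i) (hB i)
  have dAX : Disjoint A X := Finset.disjoint_left.2 fun i h h' => hA i h (hX i h')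
  have dAY : Disjoint A Y := Finset.disjoint_left.2 fun i h h' => hA i h (hY i h')
  have dBX : Disjoint B X := Finset.disjoint_left.2 fun i h h' => hB i h (hX i h')
  have dAXY : Disjoint A (X ∪ Y) := Finset.disjoint_union_right.2 ⟨dAX, dAY⟩
  have filt : ∀ (S S' : Finset ι) (c : κ), Disjoint S S' →
      ((S ∪ S').filter fun i => o i = c).card =
        (S.filter fun i => o i = c).card + (S'.filter fun i => o i = c).card := fun S S' c h => by
    rw [Finset.filter_union, Finset.card_union_of_disjoint (Finset.disjoint_filter_filter h)]
  set tw := (A ∪ B).filter fun i => ∃ j ∈ A ∪ B, j ≠ i ∧ φ j = φ i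
  have htw : 2 * ((A ∪ B).image φ).card + tw.card ≤ 2 * (A ∪ B).card :=
    two_mul_card_image_add_card_twins_le (A ∪ B) φ
  obtain ⟨f₁, hf₁, hfM₁, hMf₁⟩ := exists_involution_of_isMatching hM₁.1
  obtain ⟨f₂, hf₂, hfM₂, hMf₂⟩ := exists_involution_of_isMatching hM₂.1
  have hfW₁ : ∀ i, f₁ i ≠ i → i ∈ A ∪ (X ∪ Y) := fun i hi =>
    (hW₁ i).1 (M₁.adj_sub (hfM₁ i hi)).2.1
  have hfW₂ : ∀ i, f₂ i ≠ i → i ∈ B ∪ X := fun i hi => (hW₂ i).1 (M₂.adj_sub (hfM₂ i hi)).2.1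
  have hgf₁ : ∀ i, g₁ (f₁ i) = g₁ i := fun i => by
    by_cases h : f₁ i = i
    · rw [h]
    · exact (hgM₁ _ _ (hfM₁ i h)).symm
  have hgf₂ : ∀ i, g₂ (f₂ i) = g₂ i := fun i => by
    by_cases h : f₂ i = i
    · rw [h]
    · exact (hgM₂ _ _ (hfM₂ i h)).symm
  have c₁ := card_image_union_add_card_moved_le (P := A ∪ B) Finset.subset_union_left dAXY f₁ hf₁
    hfW₁ g₁ hgf₁
  have c₂ := card_image_union_add_card_moved_le (P := A ∪ B) Finset.subset_union_right dBX f₂ hf₂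
    hfW₂ g₂ hgf₂
  rw [Finset.image_congr fun i hi => hg₁ i (hP i hi)] at c₁
  rw [Finset.image_congr fun i hi => hg₂ i (hP i hi)] at c₂
  have m₁ := two_mul_ncard_edgeSet_le hf₁ hMf₁ hfW₁
  have m₂ := two_mul_ncard_edgeSet_le hf₂ hMf₂ hfW₂
  set p₁ := A.filter fun i => f₁ i ≠ i ∧ f₁ i ∈ A
  set p₂ := B.filter fun i => f₂ i ≠ i ∧ f₂ i ∈ B
  -- A matching edge with two colored ends saves nothing, but its ends already have the same color
  -- and hence are twins. As `A` and `B` are disjoint, no twin is charged by both matchings.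
  have hp : p₁.card + p₂.card ≤ tw.card := by
    rw [← Finset.card_union_of_disjoint
      (hAB.mono (Finset.filter_subset _ _) (Finset.filter_subset _ _))]
    refine Finset.card_le_card (Finset.union_subset ?_ ?_)
    · intro i hi
      obtain ⟨ha, hne, hfa⟩ := Finset.mem_filter.1 hi
      exact Finset.mem_filter.2 ⟨Finset.mem_union_left _ ha, f₁ i, Finset.mem_union_left _ hfa, hne,
        (eq_of_shareGraph_adj (M₁.adj_sub (hfM₁ i hne)) (hA _ ha) (hA _ hfa)).symm⟩
    · intro i hi
      obtain ⟨ha, hne, hfa⟩ := Finset.mem_filter.1 hi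
      exact Finset.mem_filter.2 ⟨Finset.mem_union_right _ ha, f₂ i, Finset.mem_union_right _ hfa,
        hne, (eq_of_shareGraph_adj (M₂.adj_sub (hfM₂ i hne)) (hB _ ha) (hB _ hfa)).symm⟩
  set C₁ : Finset κ := Finset.univ.filter fun c =>
    ∃ p : ι × ι, (shareGraph R φ W₁).Adj p.1 p.2 ∧ o p.1 = c ∧ o p.2 = c
  set C₂ : Finset κ := Finset.univ.filter fun c =>
    ∃ p : ι × ι, (shareGraph R φ W₂).Adj p.1 p.2 ∧ o p.1 = c ∧ o p.2 = c
  set C₃ : Finset κ := Finset.univ.filter fun c => ∃ s ∈ tw, ∃ t ∈ tw, s ≠ t ∧ o s = c ∧ o t = c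
  -- Choosing one admissible pair in each class of `C₁` gives disjoint edges, so a maximum matching
  -- has at least as many.
  have k₁ : C₁.card ≤ M₁.edgeSet.ncard := by
    have : ∀ c : C₁, ∃ p : ι × ι, (shareGraph R φ W₁).Adj p.1 p.2 ∧ o p.1 = c ∧ o p.2 = c :=
      fun c => (Finset.mem_filter.1 c.2).2
    rcases isEmpty_or_nonempty ι with hι | ⟨⟨i₀⟩⟩
    · rw [Finset.card_eq_zero.2 (Finset.eq_empty_of_forall_notMem fun c hc =>
        hι.elim (this ⟨c, hc⟩).choose.1)]
      exact Nat.zero_le _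
    choose p hp using this
    refine card_le_ncard_edgeSet hM₁ C₁ (fun c => if h : c ∈ C₁ then (p ⟨c, h⟩).1 else i₀)
      (fun c => if h : c ∈ C₁ then (p ⟨c, h⟩).2 else i₀) o ?_ ?_ ?_
    · intro c hc; simpa only [dif_pos hc] using (hp ⟨c, hc⟩).1
    · intro c hc; simpa only [dif_pos hc] using (hp ⟨c, hc⟩).2.1
    · intro c hc; simpa only [dif_pos hc] using (hp ⟨c, hc⟩).2.2
  have k₂ : C₂.card ≤ M₂.edgeSet.ncard := by
    have : ∀ c : C₂, ∃ p : ι × ι, (shareGraph R φ W₂).Adj p.1 p.2 ∧ o p.1 = c ∧ o p.2 = c :=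
      fun c => (Finset.mem_filter.1 c.2).2
    rcases isEmpty_or_nonempty ι with hι | ⟨⟨i₀⟩⟩
    · rw [Finset.card_eq_zero.2 (Finset.eq_empty_of_forall_notMem fun c hc =>
        hι.elim (this ⟨c, hc⟩).choose.1)]
      exact Nat.zero_le _
    choose p hp using this
    refine card_le_ncard_edgeSet hM₂ C₂ (fun c => if h : c ∈ C₂ then (p ⟨c, h⟩).1 else i₀)
      (fun c => if h : c ∈ C₂ then (p ⟨c, h⟩).2 else i₀) o ?_ ?_ ?_
    · intro c hc; simpa only [dif_pos hc] using (hp ⟨c, hc⟩).1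
    · intro c hc; simpa only [dif_pos hc] using (hp ⟨c, hc⟩).2.1
    · intro c hc; simpa only [dif_pos hc] using (hp ⟨c, hc⟩).2.2
  have k₃ : 2 * C₃.card ≤ tw.card := by
    refine le_trans (Finset.mul_card_image_le_card_of_maps_to
      (s := tw.filter fun i => o i ∈ C₃) (f := o) (fun i hi => (Finset.mem_filter.1 hi).2) 2
      fun c hc => ?_) (Finset.card_le_card (Finset.filter_subset _ _))
    obtain ⟨s, hs, t, ht, hst, rfl, hot⟩ := (Finset.mem_filter.1 hc).2
    exact Finset.one_lt_card.2 ⟨s, by simp [hs, hc], t, by simp [ht, hot, hc], hst⟩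
  have hW := weighted_card_le o A B X Y (C₁ ∪ C₂ ∪ C₃) (fun c => (filt _ _ c hAB).symm.trans_le (h1 c))
    (fun c => (filt _ _ c dBX).symm.trans_le (h2 c))
    (fun c => by rw [← filt _ _ c hXY, ← filt _ _ c dAXY]; exact h3 c) (by
      rintro c (⟨ha, hb, hx⟩ | hy)
      · obtain ⟨s, hs⟩ := Finset.card_pos.1 ha
        obtain ⟨t, ht⟩ := Finset.card_pos.1 hb
        obtain ⟨r, hr⟩ := Finset.card_pos.1 hx
        obtain ⟨hs, hsc⟩ := Finset.mem_filter.1 hs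
        obtain ⟨ht, htc⟩ := Finset.mem_filter.1 ht
        obtain ⟨hr, hrc⟩ := Finset.mem_filter.1 hr
        have hrs : r ≠ s := fun h => hA s hs (h ▸ hX r hr)
        have hrt : r ≠ t := fun h => hB t ht (h ▸ hX r hr)
        have hst : s ≠ t := fun h => Finset.disjoint_left.1 hAB hs (h ▸ ht)
        -- If neither $rs$ nor $rt$ is admissible, the colors of $s$ and $t$ recur on members that
        -- collide with $r$. By `hcol` these lie in `A ∪ B`, so $s$ and $t$ are two twins of the
        -- class.
        rcases shareGraph_adj_or_exists (W := W₁) ((hW₁ r).2 (by simp [hr])) ((hW₁ s).2 (by simp [hs]))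
          (hX r hr) (hA s hs) (ho r s hrs (hrc.trans hsc.symm)) with h | ⟨k, hks, hk, hck⟩
        · exact Finset.mem_union_left _ (Finset.mem_union_left _ (Finset.mem_filter.2
            ⟨Finset.mem_univ _, (r, s), h, hrc, hsc⟩))
        rcases shareGraph_adj_or_exists (W := W₂) ((hW₂ r).2 (by simp [hr])) ((hW₂ t).2 (by simp [ht]))
          (hX r hr) (hB t ht) (ho r t hrt (hrc.trans htc.symm)) with h | ⟨l, hlt, hl, hcl⟩
        · exact Finset.mem_union_left _ (Finset.mem_union_right _ (Finset.mem_filter.2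
            ⟨Finset.mem_univ _, (r, t), h, hrc, htc⟩))
        · refine Finset.mem_union_right _ (Finset.mem_filter.2 ⟨Finset.mem_univ _, s, ?_, t, ?_, hst,
            hsc, htc⟩)
          · exact Finset.mem_filter.2 ⟨Finset.mem_union_left _ hs, k,
              hcol r hr k (hk ▸ hA s hs) hck, hks, hk⟩
          · exact Finset.mem_filter.2 ⟨Finset.mem_union_right _ ht, l,
              hcol r hr l (hl ▸ hB t ht) hcl, hlt, hl⟩
      · obtain ⟨r, hr, s, hs, hrs⟩ := Finset.one_lt_card.1 hy
        obtain ⟨hr, hrc⟩ := Finset.mem_filter.1 hr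
        obtain ⟨hs, hsc⟩ := Finset.mem_filter.1 hs
        refine Finset.mem_union_left _ (Finset.mem_union_left _ (Finset.mem_filter.2
            ⟨Finset.mem_univ _, (r, s), ⟨hrs, (hW₁ r).2 (by simp [hr]), (hW₁ s).2 (by simp [hs]), ?_⟩,
              hrc, hsc⟩))
        have hr' := hY r hr
        have hs' := hY s hs
        rintro (h' | (h' | h') | (h' | h'))
        · exact ho r s hrs (hrc.trans hsc.symm) h'.2
        · exact h'.1 hr'
        · exact h'.2.1 hs'
        · exact h'.1 hs'
        · exact h'.2.1 hr')
  have hC : (C₁ ∪ C₂ ∪ C₃).card ≤ C₁.card + C₂.card + C₃.card :=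
    (Finset.card_union_le _ _).trans (Nat.add_le_add_right (Finset.card_union_le _ _) _)
  have hABc : (A ∪ B).card = A.card + B.card := Finset.card_union_of_disjoint hAB
  have hXYc : (X ∪ Y).card = X.card + Y.card := Finset.card_union_of_disjoint hXY
  omega

/-! ### First fit -/

/-- Colliding members carry different colors. -/
def IsValid (R : ι → RootedSubtree T) (φ : ι → Option ℕ) : Prop :=
  ∀ i j c, i ≠ j → φ i = some c → φ j = some c → ¬ Collide (R i) (R j)

/-- The colors used form an initial segment of `ℕ`. -/
def IsInitial (φ : ι → Option ℕ) : Prop :=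
  ∀ i m, φ i = some m → ∀ c ≤ m, ∃ j, φ j = some c

theorem exists_of_lt_minFree {R : ι → RootedSubtree T} {φ : ι → Option ℕ} {r s : ι} {c : ℕ}
    (h : c < minFree R φ r s) :
    ∃ i, (Collide (R r) (R i) ∨ Collide (R s) (R i)) ∧ φ i = some c := by
  by_contra hc
  exact absurd (Nat.sInf_le (s := {m : ℕ | ¬ ∃ i, (Collide (R r) (R i) ∨ Collide (R s) (R i)) ∧
    φ i = some m}) hc) (not_le.2 h)

/-- Only finitely many colors are carried, so the infimum is over a nonempty set and is attained,
rather than being the default value $0$. -/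
theorem minFree_spec [Finite ι] (R : ι → RootedSubtree T) (φ : ι → Option ℕ) (r s : ι) :
    ¬ ∃ i, (Collide (R r) (R i) ∨ Collide (R s) (R i)) ∧ φ i = some (minFree R φ r s) := by
  refine Nat.sInf_mem (s := {m : ℕ | ¬ ∃ i, (Collide (R r) (R i) ∨ Collide (R s) (R i)) ∧
    φ i = some m}) ?_
  have hfin : (some ⁻¹' Set.range φ).Finite :=
    (Set.finite_range φ).preimage (Option.some_injective ℕ).injOn
  obtain ⟨m, hm⟩ := hfin.exists_notMem
  exact ⟨m, fun ⟨i, _, hi⟩ => hm ⟨i, hi⟩⟩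

/-- Invariant of the coloring loop: partners of uncolored members of `S` are uncolored members of
`S`, and `X` contains all members that matter for the colors of the uncolored members of `S`. -/
structure FitHyp (R : ι → RootedSubtree T) {G : SimpleGraph ι} (M : G.Subgraph) (S : Set ι)
    (X : Finset ι) (φ : ι → Option ℕ) : Prop where
  partner : ∀ r ∈ S, φ r = none → ∀ s, M.Adj r s → s ∈ S ∧ φ s = none
  mem : ∀ r ∈ S, φ r = none → r ∈ X
  nbr : ∀ r ∈ S, φ r = none → ∀ j, Collide (R r) (R j) → φ j ≠ none ∨ j ∈ S → j ∈ X

/-- What the coloring loop achieves. -/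
structure FitSpec (R : ι → RootedSubtree T) {G : SimpleGraph ι} (M : G.Subgraph) (S : Set ι)
    (X : Finset ι) (φ φ' : ι → Option ℕ) : Prop where
  ext : ∀ i, φ i ≠ none → φ' i = φ i
  ne_none_iff : ∀ i, φ' i ≠ none ↔ φ i ≠ none ∨ i ∈ S
  valid : IsValid R φ → IsValid R φ'
  initial : IsInitial φ → IsInitial φ'
  pair : ∀ r ∈ S, φ r = none → ∀ s, M.Adj r s → φ' r = φ' s
  bound : ∀ r m, φ r = none → φ' r = some m → ∀ c ≤ m, ∃ j ∈ X, φ' j = some c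

/-- A single member is treated as the pair with $s=r$. `FitHyp` makes the partner uncolored, so no
color is ever overwritten. Every color below the new one blocks $r$ or $s$, and therefore occurs in
`X`; this persists to the end of the loop. -/
theorem FitSpec.step [Finite ι] [DecidableEq ι] {R : ι → RootedSubtree T} {G : SimpleGraph ι}
    {M : G.Subgraph} (hM : M.IsMatching) (hMR : ∀ r s, M.Adj r s → ¬ Collide (R r) (R s))
    {S : Set ι} {X : Finset ι} {φ φ' : ι → Option ℕ} (H : FitHyp R M S X φ) {r s : ι} (hr : r ∈ S)
    (hφ : φ r = none) (hs : M.Adj r s ∨ s = r ∧ ∀ t, ¬ M.Adj r t)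
    (ih : FitHyp R M S X (Function.update (Function.update φ r (some (minFree R φ r s)))
        s (some (minFree R φ r s))) →
      FitSpec R M S X (Function.update (Function.update φ r (some (minFree R φ r s)))
        s (some (minFree R φ r s))) φ') :
    FitSpec R M S X φ φ' := by
  set m := minFree R φ r s with hm
  set ψ := Function.update (Function.update φ r (some m)) s (some m) with hψ
  have hsS : s ∈ S ∧ φ s = none := by
    rcases hs with h | h
    · exact H.partner r hr hφ s h
    · rw [h.1]; exact ⟨hr, hφ⟩
  have ψr : ψ r = some m := by
    by_cases h : r = s <;> simp [hψ, h]
  have ψs : ψ s = some m := by simp [hψ]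
  have ψo : ∀ i, i ≠ r → i ≠ s → ψ i = φ i := fun i h1 h2 => by simp [hψ, h1, h2]
  have ψext : ∀ i, φ i ≠ none → ψ i = φ i := fun i hi =>
    ψo i (fun h => hi (h ▸ hφ)) (fun h => hi (h ▸ hsS.2))
  have ψnone : ∀ i, ψ i = none → φ i = none ∧ i ≠ r ∧ i ≠ s := fun i hi => by
    have h1 : i ≠ r := fun h => by rw [h, ψr] at hi; cases hi
    have h2 : i ≠ s := fun h => by rw [h, ψs] at hi; cases hi
    exact ⟨ψo i h1 h2 ▸ hi, h1, h2⟩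
  have ψnn : ∀ i, ψ i ≠ none → φ i ≠ none ∨ i ∈ S := fun i hi => by
    by_cases h1 : i = r
    · exact Or.inr (h1 ▸ hr)
    by_cases h2 : i = s
    · exact Or.inr (h2 ▸ hsS.1)
    · exact Or.inl (ψo i h1 h2 ▸ hi)
  have hfree := minFree_spec R φ r s
  rw [← hm] at hfree
  have hlow : ∀ c < m, ∃ j ∈ X, φ j = some c := fun c hc => by
    obtain ⟨j, hj | hj, hjc⟩ := exists_of_lt_minFree hc
    · exact ⟨j, H.nbr r hr hφ j hj (Or.inl (by simp [hjc])), hjc⟩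
    · exact ⟨j, H.nbr s hsS.1 hsS.2 j hj (Or.inl (by simp [hjc])), hjc⟩
  have hlow' : ∀ c ≤ m, ∃ j ∈ X, ψ j = some c := fun c hc => by
    rcases hc.lt_or_eq with hc | rfl
    · obtain ⟨j, hj, hjc⟩ := hlow c hc
      exact ⟨j, hj, by rw [ψext j (by simp [hjc]), hjc]⟩
    · exact ⟨r, H.mem r hr hφ, ψr⟩
  have K := ih
    { partner := fun r' hr' hφ' s' hs' => by
        obtain ⟨h1, h2, h3⟩ := ψnone r' hφ'
        obtain ⟨h4, h5⟩ := H.partner r' hr' h1 s' hs'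
        refine ⟨h4, ?_⟩
        rw [ψo s' ?_ ?_, h5]
        · rintro rfl
          rcases hs with h | h
          · exact h3 (adj_right_unique hM hs'.symm h)
          · exact h.2 _ hs'.symm
        · rintro rfl
          rcases hs with h | h
          · exact h2 (adj_right_unique hM hs'.symm h.symm)
          · rw [h.1] at hs'
            exact h.2 _ hs'.symm
      mem := fun r' hr' hφ' => H.mem r' hr' (ψnone r' hφ').1
      nbr := fun r' hr' hφ' j hj hjS => H.nbr r' hr' (ψnone r' hφ').1 j hj (by
        rcases hjS with h | h
        · exact ψnn j h
        · exact Or.inr h) }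
  refine ⟨fun i hi => ?_, fun i => ?_, fun hv => K.valid ?_, fun hv => K.initial ?_, ?_, ?_⟩
  · rw [K.ext i (by rw [ψext i hi]; exact hi), ψext i hi]
  · rw [K.ne_none_iff]
    refine ⟨fun h => h.elim (ψnn i) Or.inr, fun h => h.imp (fun h => ?_) id⟩
    rw [ψext i h]; exact h
  · have hnew : ∀ i j, (i = r ∨ i = s) → ψ j = some m → i ≠ j → ¬ Collide (R i) (R j) := by
      intro i j hi hj hij hcol
      by_cases h1 : j = r ∨ j = s
      · rcases hs with h | h
        · rcases hi with rfl | rfl <;> rcases h1 with rfl | rfl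
          · exact hij rfl
          · exact hMR _ _ h hcol
          · exact hMR _ _ h hcol.symm
          · exact hij rfl
        · rw [h.1] at hi h1
          exact hij ((or_self_iff.1 hi).trans (or_self_iff.1 h1).symm)
      · push Not at h1
        rw [ψo j h1.1 h1.2] at hj
        refine hfree ⟨j, ?_, hj⟩
        rcases hi with rfl | rfl
        · exact Or.inl hcol
        · exact Or.inr hcol
    intro i j c hij hi hj
    by_cases h1 : i = r ∨ i = s
    · have : c = m := by
        rcases h1 with rfl | rfl
        · rw [ψr] at hi; exact (Option.some.inj hi).symm
        · rw [ψs] at hi; exact (Option.some.inj hi).symm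
      exact hnew i j h1 (this ▸ hj) hij
    by_cases h2 : j = r ∨ j = s
    · have : c = m := by
        rcases h2 with rfl | rfl
        · rw [ψr] at hj; exact (Option.some.inj hj).symm
        · rw [ψs] at hj; exact (Option.some.inj hj).symm
      exact fun hc => hnew j i h2 (this ▸ hi) hij.symm hc.symm
    push Not at h1 h2
    rw [ψo i h1.1 h1.2] at hi
    rw [ψo j h2.1 h2.2] at hj
    exact hv i j c hij hi hj
  · intro i n hi c hc
    by_cases h : φ i = none
    · have : n = m := by
        by_cases h1 : i = r
        · rw [h1, ψr] at hi; exact (Option.some.inj hi).symm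
        by_cases h2 : i = s
        · rw [h2, ψs] at hi; exact (Option.some.inj hi).symm
        · rw [ψo i h1 h2, h] at hi; cases hi
      obtain ⟨j, _, hj⟩ := hlow' c (this ▸ hc)
      exact ⟨j, hj⟩
    · rw [ψext i h] at hi
      obtain ⟨j, hj⟩ := hv i n hi c hc
      exact ⟨j, by rw [ψext j (by simp [hj]), hj]⟩
  · intro r' hr' hφ' s' hs'
    by_cases h : ψ r' = none
    · exact K.pair r' hr' h s' hs'
    · have hcase : r' = r ∨ r' = s := by
        by_contra hc
        push Not at hc
        exact h (by rw [ψo r' hc.1 hc.2, hφ'])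
      have : ψ s' = ψ r' := by
        rcases hs with hs | hs
        · rcases hcase with rfl | rfl
          · rw [adj_right_unique hM hs' hs, ψs, ψr]
          · rw [adj_right_unique hM hs' hs.symm, ψs, ψr]
        · rw [hs.1, or_self_iff] at hcase
          exact absurd (hcase ▸ hs') (hs.2 s')
      rw [K.ext r' h, K.ext s' (this ▸ h), this]
  · intro i n hi hi' c hc
    by_cases h : ψ i = none
    · exact K.bound i n h hi' c hc
    · have : n = m := by
        rw [K.ext i h] at hi'
        by_cases h1 : i = r
        · rw [h1, ψr] at hi'; exact (Option.some.inj hi').symm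
        by_cases h2 : i = s
        · rw [h2, ψs] at hi'; exact (Option.some.inj hi').symm
        · rw [ψo i h1 h2, hi] at hi'; cases hi'
      obtain ⟨j, hjX, hj⟩ := hlow' c (this ▸ hc)
      exact ⟨j, hjX, by rw [K.ext j (by simp [hj]), hj]⟩

theorem MatchedFit.fitSpec [Finite ι] [DecidableEq ι] {R : ι → RootedSubtree T}
    {G : SimpleGraph ι} {M : G.Subgraph} (hM : M.IsMatching)
    (hMR : ∀ r s, M.Adj r s → ¬ Collide (R r) (R s)) {S : Set ι} {X : Finset ι}
    {φ φ' : ι → Option ℕ} (h : MatchedFit R M S φ φ') (H : FitHyp R M S X φ) :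
    FitSpec R M S X φ φ' := by
  induction h with
  | done φ h =>
    exact ⟨fun _ _ => rfl, fun i => ⟨Or.inl, fun hi => hi.elim id (h i)⟩, id, id,
      fun r hr hφ => absurd hφ (h r hr), fun r m h1 h2 => by rw [h1] at h2; cases h2⟩
  | pair φ φ' r s hr hφ hrs _ ih => exact FitSpec.step hM hMR H hr hφ (Or.inl hrs) ih
  | single φ φ' r hr hφ hrs _ ih =>
    refine FitSpec.step hM hMR H hr hφ (Or.inr ⟨rfl, hrs⟩) ?_
    rw [Function.update_idem]
    exact ih

theorem ncard_none_update_lt [Finite ι] [DecidableEq ι] {φ ψ : ι → Option ℕ} {r : ι}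
    (hφ : φ r = none) (hr : ψ r ≠ none) (h : ∀ i, ψ i = none → φ i = none) :
    {i | ψ i = none}.ncard < {i | φ i = none}.ncard :=
  Set.ncard_lt_ncard ⟨h, fun h' => hr (h' hφ)⟩ (Set.toFinite _)

/-- Each step lowers the number of uncolored members, even if it recolors a partner, so termination
needs no invariant. -/
theorem exists_matchedFit [Finite ι] [DecidableEq ι] (R : ι → RootedSubtree T)
    {G : SimpleGraph ι} (M : G.Subgraph) (S : Set ι) (φ : ι → Option ℕ) :
    ∃ φ', MatchedFit R M S φ φ' := by
  induction hn : {i | φ i = none}.ncard using Nat.strong_induction_on generalizing φ with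
  | _ n ih =>
    by_cases h : ∀ i ∈ S, φ i ≠ none
    · exact ⟨φ, .done φ h⟩
    push Not at h
    obtain ⟨r, hr, hφ⟩ := h
    by_cases hs : ∃ s, M.Adj r s
    · obtain ⟨s, hs⟩ := hs
      obtain ⟨φ', h'⟩ := ih _ (hn ▸ ncard_none_update_lt (ψ := Function.update (Function.update φ r
        (some (minFree R φ r s))) s (some (minFree R φ r s))) (r := r) hφ
        (by by_cases h : r = s <;> simp [h]) fun i hi => by
          by_cases h1 : i = s
          · simp [h1] at hi
          by_cases h2 : i = r
          · rw [h2, hφ]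
          · simpa [h1, h2] using hi) _ rfl
      exact ⟨φ', .pair φ φ' r s hr hφ hs h'⟩
    · obtain ⟨φ', h'⟩ := ih _ (hn ▸ ncard_none_update_lt (ψ := Function.update φ r
        (some (minFree R φ r r))) (r := r) hφ (by simp) fun i hi => by
          by_cases h2 : i = r
          · rw [h2, hφ]
          · simpa [h2] using hi) _ rfl
      exact ⟨φ', .single φ φ' r hr hφ (not_exists.1 hs) h'⟩

/-- First fit is the matched loop for the empty matching, so one analysis serves both. -/
theorem firstFit_iff_matchedFit_bot [DecidableEq ι] {R : ι → RootedSubtree T} {S : Set ι}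
    {φ φ' : ι → Option ℕ} :
    FirstFit R S φ φ' ↔ MatchedFit R (⊥ : (⊤ : SimpleGraph ι).Subgraph) S φ φ' := by
  constructor
  · intro h
    induction h with
    | done φ h => exact .done φ h
    | step φ φ' r hr hφ _ ih => exact .single φ φ' r hr hφ (fun _ h => h) ih
  · intro h
    induction h with
    | done φ h => exact .done φ h
    | pair φ φ' r s hr hφ hs => exact hs.elim
    | single φ φ' r hr hφ _ _ ih => exact .step φ φ' r hr hφ ih

theorem exists_firstFit [Finite ι] [DecidableEq ι] (R : ι → RootedSubtree T) (S : Set ι)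
    (φ : ι → Option ℕ) : ∃ φ', FirstFit R S φ φ' := by
  simp only [firstFit_iff_matchedFit_bot]
  exact exists_matchedFit R _ S φ

theorem FirstFit.fitSpec [Finite ι] [DecidableEq ι] {R : ι → RootedSubtree T} {S : Set ι}
    {X : Finset ι} {φ φ' : ι → Option ℕ} (h : FirstFit R S φ φ')
    (H : ∀ r ∈ S, φ r = none → r ∈ X ∧
      ∀ j, Collide (R r) (R j) → φ j ≠ none ∨ j ∈ S → j ∈ X) :
    FitSpec R (⊥ : (⊤ : SimpleGraph ι).Subgraph) S X φ φ' :=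
  MatchedFit.fitSpec (M := (⊥ : (⊤ : SimpleGraph ι).Subgraph)) (fun _ h => False.elim h)
    (fun _ _ h => False.elim h) (firstFit_iff_matchedFit_bot.1 h)
    ⟨fun _ _ _ _ h => h.elim, fun r hr hφ => (H r hr hφ).1, fun r hr hφ => (H r hr hφ).2⟩

/-! ### The transfer of colors -/

theorem exists_isMaximumMatching [Finite ι] (G : SimpleGraph ι) :
    ∃ M : G.Subgraph, IsMaximumMatching M := by
  have hne : {M : G.Subgraph | M.IsMatching}.Nonempty := ⟨⊥, fun _ h => h.elim⟩
  obtain ⟨M, hM, hmax⟩ := (Set.toFinite {M : G.Subgraph | M.IsMatching}).exists_maximalFor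
    (fun M : G.Subgraph => M.edgeSet.ncard) _ hne
  refine ⟨M, hM, fun M' hM' => ?_⟩
  rcases le_total M'.edgeSet.ncard M.edgeSet.ncard with h | h
  · exact h
  · exact hmax hM' h

theorem exists_transfer {G : SimpleGraph ι} {M : G.Subgraph} (hM : M.IsMatching)
    (φ : ι → Option ℕ) : ∃ φ', Transfer M φ φ' := by
  classical
  refine ⟨fun r => if h : φ r = none ∧ ∃ s, φ s ≠ none ∧ M.Adj r s then φ h.2.choose else φ r,
    fun r s hr hs hrs => ?_, fun r hr => dif_neg hr⟩
  have h : φ r = none ∧ ∃ s, φ s ≠ none ∧ M.Adj r s := ⟨hr, s, hs, hrs⟩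
  simp only [dif_pos h]
  rw [adj_right_unique hM h.2.choose_spec.2 hrs]

/-- Pigeonhole: three members, two directions. Both the bound of two members per class and edge and
the validity of the color transfer rest on it. -/
theorem collide_or_collide_of_present {A B C : RootedSubtree T} {a b : V} (hA : Present A a b)
    (hB : Present B a b) (hC : Present C a b) :
    Collide A B ∨ Collide A C ∨ Collide B C := by
  rcases hA with hA | hA <;> rcases hB with hB | hB <;> rcases hC with hC | hC <;>
    first
      | exact Or.inl ⟨_, _, hA, hB⟩
      | exact Or.inr (Or.inl ⟨_, _, hA, hC⟩)
      | exact Or.inr (Or.inr ⟨_, _, hB, hC⟩)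

/-- The effect of a matching subroutine on a set `W` of members present on a common edge. -/
theorem matchedFit_transfer_spec [Finite ι] [DecidableEq ι] {R : ι → RootedSubtree T}
    {φ φ₁ φ₂ : ι → Option ℕ} {W S : Set ι} {M : (shareGraph R φ W).Subgraph} (hM : M.IsMatching)
    (hT : Transfer M φ φ₁) (hF : MatchedFit R M S φ₁ φ₂) (hS : ∀ i, i ∈ S ↔ i ∈ W ∧ φ i = none)
    (hv : IsValid R φ) (hin : IsInitial φ) {a b : V} (hW : ∀ i ∈ W, Present (R i) a b)
    {X : Finset ι} (hSX : ∀ i ∈ S, i ∈ X)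
    (hX : ∀ i ∈ S, ∀ j, φ j ≠ none → Collide (R i) (R j) → j ∈ X) :
    (∀ i, φ i ≠ none → φ₂ i = φ i) ∧ (∀ i, φ₂ i ≠ none ↔ φ i ≠ none ∨ i ∈ S) ∧ IsValid R φ₂ ∧
      IsInitial φ₂ ∧ (∀ i j, M.Adj i j → φ₂ i = φ₂ j) ∧
      ∀ r m, φ₂ r = some m → (∃ s, φ s = some m) ∨ ∀ c ≤ m, ∃ j ∈ X, φ₂ j = some c := by
  have hWM : ∀ i j, M.Adj i j → i ∈ W := fun i j h => (M.adj_sub h).2.1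
  have hcase : ∀ i, φ₁ i = φ i ∨ φ i = none ∧ ∃ s, φ s ≠ none ∧ M.Adj i s ∧ φ₁ i = φ s := by
    intro i
    by_cases h : φ i = none ∧ ∃ s, φ s ≠ none ∧ M.Adj i s
    · obtain ⟨h1, s, h2, h3⟩ := h
      exact Or.inr ⟨h1, s, h2, h3, hT.1 i s h1 h2 h3⟩
    · exact Or.inl (hT.2 i h)
  have hext : ∀ i, φ i ≠ none → φ₁ i = φ i := fun i hi => hT.2 i fun h => hi h.1
  have hnn : ∀ i, φ₁ i ≠ none → φ i ≠ none ∨ i ∈ S := fun i hi => by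
    rcases hcase i with h | ⟨h1, s, h2, h3, h4⟩
    · exact Or.inl (h ▸ hi)
    · exact Or.inr ((hS i).2 ⟨hWM i s h3, h1⟩)
  have hnone : ∀ i, φ₁ i = none → φ i = none := fun i hi => by
    by_contra h
    exact h (hext i h ▸ hi)
  have hold : ∀ i c, φ₁ i = some c → ∃ s, φ s = some c := fun i c hi => by
    rcases hcase i with h | ⟨_, s, _, _, h4⟩
    · exact ⟨i, h ▸ hi⟩
    · exact ⟨s, h4 ▸ hi⟩
  have hforb : ∀ i s k, φ i = none → φ s ≠ none → M.Adj i s → φ k = φ s →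
      ¬ Collide (R i) (R k) := fun i s k h1 h2 h3 h4 h5 =>
    (M.adj_sub h3).2.2.2 (Or.inr (Or.inl (Or.inr ⟨h1, h2, k, h4, h5⟩)))
  have hv₁ : IsValid R φ₁ := by
    intro i j c hij hi hj
    rcases hcase i with h | ⟨h1, s, h2, h3, h4⟩ <;> rcases hcase j with h' | ⟨h1', s', h2', h3', h4'⟩
    · exact hv i j c hij (h ▸ hi) (h' ▸ hj)
    · exact fun hc => hforb j s' i h1' h2' h3' (by rw [← h, hi, ← h4', hj]) hc.symm
    · exact hforb i s j h1 h2 h3 (by rw [← h', hj, ← h4, hi])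
    -- Here $i$ and $j$ would have received the same color from different members $s$, $s'$. This
    -- cannot happen: $i,s,s'$ are present on one edge, yet $i$ collides with no member of that
    -- color, and $s,s'$ do not collide because `φ` is valid.
    · have hss : s ≠ s' := by
        rintro rfl
        exact hij (adj_right_unique hM h3.symm h3'.symm)
      rcases collide_or_collide_of_present (hW i (hWM _ _ h3)) (hW s (hWM _ _ h3.symm))
        (hW s' (hWM _ _ h3'.symm)) with hc | hc | hc
      · exact absurd hc (hforb i s s h1 h2 h3 rfl)
      · exact absurd hc (hforb i s s' h1 h2 h3 (by rw [← h4', hj, ← h4, hi]))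
      · exact absurd hc (hv s s' c hss (by rw [← h4, hi]) (by rw [← h4', hj]))
  have hin₁ : IsInitial φ₁ := by
    intro i m hi c hc
    obtain ⟨s, hs⟩ := hold i m hi
    obtain ⟨j, hj⟩ := hin s m hs c hc
    exact ⟨j, by rw [hext j (by simp [hj]), hj]⟩
  have K : FitSpec R M S X φ₁ φ₂ := hF.fitSpec hM
    (fun r s h => not_collide_of_shareGraph_adj (M.adj_sub h))
    -- A member left uncolored by the transfer has no colored partner, and its uncolored partner,
    -- whose only partner it is, received no color either.
    { partner := fun r hr hφ s hs => by
        have h1 := hnone r hφ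
        have h2 : φ s = none := by
          by_contra h
          exact h (hT.1 r s h1 h hs ▸ hφ)
        refine ⟨(hS s).2 ⟨hWM _ _ hs.symm, h2⟩, ?_⟩
        rcases hcase s with h | ⟨_, t, h3, h4, _⟩
        · rw [h, h2]
        · rw [adj_right_unique hM h4 hs.symm] at h3
          exact absurd h1 h3
      mem := fun r hr _ => hSX r hr
      nbr := fun r hr _ j hj hjS => by
        by_cases h : φ j = none
        · rcases hjS with h' | h'
          · exact hSX j ((hnn j h').resolve_left fun h'' => h'' h)
          · exact hSX j h'
        · exact hX r hr j h hj }
  refine ⟨fun i hi => ?_, fun i => ?_, K.valid hv₁, K.initial hin₁, fun i j hij => ?_,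
    fun r m hr => ?_⟩
  · rw [K.ext i (by rw [hext i hi]; exact hi), hext i hi]
  · rw [K.ne_none_iff]
    refine ⟨fun h => h.elim (hnn i) Or.inr, fun h => h.imp (fun h => ?_) id⟩
    rw [hext i h]; exact h
  · have aux : ∀ i j, M.Adj i j → φ i = none → φ₂ i = φ₂ j := fun i j hij hi => by
      by_cases h : φ₁ i = none
      · exact K.pair i ((hS i).2 ⟨hWM _ _ hij, hi⟩) h j hij
      · rcases hcase i with h' | ⟨_, s, h2, h3, h4⟩
        · exact absurd (h'.trans hi) h
        · rw [adj_right_unique hM hij h3, K.ext i h, h4,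
            K.ext s (by rw [hext s h2]; exact h2), hext s h2]
    by_cases hi : φ i = none
    · exact aux i j hij hi
    by_cases hj : φ j = none
    · exact (aux j i hij.symm hj).symm
    · have := eq_of_shareGraph_adj (M.adj_sub hij) hi hj
      rw [K.ext i (by rw [hext i hi]; exact hi), K.ext j (by rw [hext j hj]; exact hj), hext i hi,
        hext j hj, this]
  · by_cases h : φ₁ r = none
    · exact Or.inr (K.bound r m h hr)
    · rw [K.ext r h] at hr
      exact Or.inl (hold r m hr)

/-! ### The search -/

/-- `Reach T es D`: the edges `es` are discovered one after the other from a root, and `D` is the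
set of vertices discovered. -/
inductive Reach (T : SimpleGraph V) : List (V × V) → Set V → Prop
  | nil (r : V) : Reach T [] {r}
  | snoc (es : List (V × V)) (D : Set V) (u v : V) (h : Reach T es D) (huv : T.Adj u v)
      (hu : u ∈ D) (hv : v ∉ D) : Reach T (es ++ [(u, v)]) (insert v D)

theorem Reach.of_snoc {es : List (V × V)} {u v : V} {D : Set V} (h : Reach T (es ++ [(u, v)]) D) :
    ∃ D₀, Reach T es D₀ ∧ T.Adj u v ∧ u ∈ D₀ ∧ v ∉ D₀ ∧ D = insert v D₀ := by
  generalize hl : es ++ [(u, v)] = l at h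
  cases h with
  | nil r => simp at hl
  | snoc es' D₀ u' v' h huv hu hv =>
    obtain ⟨rfl, h2⟩ := List.append_inj' hl rfl
    simp only [List.cons.injEq, Prod.mk.injEq, and_true] at h2
    obtain ⟨rfl, rfl⟩ := h2
    exact ⟨D₀, h, huv, hu, hv, rfl⟩

theorem Reach.append_star {es : List (V × V)} {D : Set V} (h : Reach T es D) {u : V} (hu : u ∈ D)
    {L : List V} (hnd : L.Nodup) (hL : ∀ w ∈ L, T.Adj u w ∧ w ∉ D) :
    Reach T (es ++ L.map fun w => (u, w)) (D ∪ {w | w ∈ L}) := by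
  induction L generalizing es D with
  | nil => simpa using h
  | cons w L ih =>
    have hw := hL w (by simp)
    have := ih (Reach.snoc es D u w h hw.1 hu hw.2) (Or.inr hu) hnd.of_cons fun x hx =>
      ⟨(hL x (by simp [hx])).1, fun hx' => by
        rcases hx' with rfl | hx'
        · exact (List.nodup_cons.1 hnd).1 hx
        · exact (hL x (by simp [hx])).2 hx'⟩
    have hD : D ∪ {x | x ∈ w :: L} = insert w D ∪ {x | x ∈ L} := by
      ext x
      simp only [List.mem_cons, Set.mem_union, Set.mem_ofPred_eq, Set.mem_insert_iff]
      tauto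
    rw [hD]
    simpa using this

/-- Of the search only this is needed: each edge leads from a discovered to an undiscovered vertex,
and finally no edge leaves the discovered set. The latter holds because only queued vertices may
have undiscovered neighbours. -/
theorem BFSFrom.reach {q : List V} {D : Set V} {es es₀ : List (V × V)} (h : BFSFrom T q D es)
    (hq : ∀ x ∈ q, x ∈ D) (h₀ : Reach T es₀ D)
    (hcl : ∀ a ∈ D, a ∉ q → ∀ b, T.Adj a b → b ∈ D) :
    ∃ D', Reach T (es₀ ++ es) D' ∧ ∀ a ∈ D', ∀ b, T.Adj a b → b ∈ D' := by
  induction h generalizing es₀ with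
  | nil D => exact ⟨D, by simpa using h₀, fun a ha b hab => hcl a ha (by simp) b hab⟩
  | cons u q D L es hnd hL _ ih =>
    have h1 := h₀.append_star (hq u (by simp)) hnd fun w hw => (hL w).1 hw
    obtain ⟨D', hD', hcl'⟩ := ih (fun x hx => (List.mem_append.1 hx).imp
      (fun h => hq x (by simp [h])) id) h1 (fun a ha haq b hab => by
        rw [List.mem_append, not_or] at haq
        have haD : a ∈ D := ha.resolve_right haq.2
        by_cases hau : a = u
        · subst hau
          by_cases hb : b ∈ D
          · exact Or.inl hb
          · exact Or.inr ((hL b).2 ⟨hab, hb⟩)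
        · exact Or.inl (hcl a haD (by simp [hau, haq.1]) b hab))
    exact ⟨D', by simpa using hD', hcl'⟩

theorem exists_bfsFrom [Finite V] (T : SimpleGraph V) (q : List V) (D : Set V) :
    ∃ es, BFSFrom T q D es := by
  -- Dequeuing $u$ lowers this sum by one: the newly discovered vertices merely pass from the first
  -- summand to the second.
  induction hn : Dᶜ.ncard + q.length using Nat.strong_induction_on generalizing q D with
  | _ n ih =>
    cases q with
    | nil => exact ⟨[], .nil D⟩
    | cons u q =>
      have hfin : {w | T.Adj u w ∧ w ∉ D}.Finite := Set.toFinite _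
      set L := hfin.toFinset.toList with hLdef
      have hL : ∀ w, w ∈ L ↔ T.Adj u w ∧ w ∉ D := fun w => by simp [hLdef]
      have hlen : L.length = {w | T.Adj u w ∧ w ∉ D}.ncard := by
        rw [hLdef, Finset.length_toList, Set.ncard_eq_toFinset_card _ hfin]
      have hc : (D ∪ {w | w ∈ L})ᶜ.ncard + L.length = Dᶜ.ncard := by
        rw [hlen, ← Set.ncard_sdiff_add_ncard_of_subset (s := {w | T.Adj u w ∧ w ∉ D}) (t := Dᶜ)
          (fun w hw => hw.2)]
        congr 2
        ext w
        simp only [Set.mem_compl_iff, Set.mem_union, Set.mem_ofPred_eq, hL, Set.mem_sdiff]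
        tauto
      obtain ⟨es, hes⟩ := ih _ (by
        rw [← hn, List.length_append, List.length_cons]
        omega) (q ++ L) (D ∪ {w | w ∈ L}) rfl
      exact ⟨_, .cons u q D L es (Finset.nodup_toList _) hL hes⟩

/-! ### Paths in the tree -/

/-- Any two vertices of `D` are joined by a path inside `D`. -/
def PathConnected (T : SimpleGraph V) (D : Set V) : Prop :=
  ∀ a ∈ D, ∀ b ∈ D, ∃ p : T.Walk a b, p.IsPath ∧ ∀ x ∈ p.support, x ∈ D

theorem Reach.pathConnected {es : List (V × V)} {D : Set V} (h : Reach T es D) :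
    PathConnected T D := by
  classical
  have key : ∃ r, ∀ a ∈ D, ∃ p : T.Walk r a, ∀ x ∈ p.support, x ∈ D := by
    induction h with
    | nil r =>
      refine ⟨r, fun a ha => ?_⟩
      obtain rfl := Set.mem_singleton_iff.1 ha
      exact ⟨.nil, by simp⟩
    | snoc es D u v _ huv hu _ ih =>
      obtain ⟨r, hr⟩ := ih
      refine ⟨r, fun a ha => ?_⟩
      rcases ha with rfl | ha
      · obtain ⟨p, hp⟩ := hr u hu
        refine ⟨p.concat huv, fun x hx => ?_⟩
        rw [SimpleGraph.Walk.support_concat, List.mem_append] at hx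
        rcases hx with hx | hx
        · exact Or.inr (hp x hx)
        · exact Or.inl (by simpa using hx)
      · obtain ⟨p, hp⟩ := hr a ha
        exact ⟨p, fun x hx => Or.inr (hp x hx)⟩
  obtain ⟨r, hr⟩ := key
  intro a ha b hb
  obtain ⟨p, hp⟩ := hr a ha
  obtain ⟨q, hq⟩ := hr b hb
  refine ⟨(p.reverse.append q).bypass, SimpleGraph.Walk.bypass_isPath _, fun x hx => ?_⟩
  have := SimpleGraph.Walk.support_bypass_subset_support _ hx
  rw [SimpleGraph.Walk.mem_support_append_iff] at this
  rcases this with h | h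
  · exact hp x (by simpa using h)
  · exact hq x h

/-- A new vertex has just one discovered neighbour, since a path inside `D` between two of them
would close a cycle. Hence discovering it leaves no unprocessed edge inside the discovered set. -/
theorem Reach.processed_iff (hT : T.IsAcyclic) {es : List (V × V)} {D : Set V}
    (h : Reach T es D) (a b : V) : Processed es a b ↔ T.Adj a b ∧ a ∈ D ∧ b ∈ D := by
  induction h generalizing a b with
  | nil r =>
    simp only [Processed, List.not_mem_nil, or_self, Set.mem_singleton_iff, false_iff]
    rintro ⟨h, rfl, rfl⟩
    exact h.ne rfl
  | snoc es D u v h huv hu hv ih =>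
    have huniq : ∀ y ∈ D, T.Adj y v → y = u := fun y hy hyv => by
      obtain ⟨p, hp, hpD⟩ := h.pathConnected y hy u hu
      have := hT.eq_snd_of_adj_start (p := SimpleGraph.Walk.cons hyv.symm p)
        (hp.cons fun h => hv (hpD _ h)) huv.symm (by simp)
      simpa using this.symm
    have e : Processed (es ++ [(u, v)]) a b ↔
        Processed es a b ∨ (a = u ∧ b = v) ∨ (a = v ∧ b = u) := by
      simp only [Processed, List.mem_append, List.mem_singleton, Prod.mk.injEq]
      tauto
    rw [e, ih]
    constructor
    · rintro (h | ⟨rfl, rfl⟩ | ⟨rfl, rfl⟩)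
      · exact ⟨h.1, Or.inr h.2.1, Or.inr h.2.2⟩
      · exact ⟨huv, Or.inr hu, Or.inl rfl⟩
      · exact ⟨huv.symm, Or.inl rfl, Or.inr hu⟩
    · rintro ⟨hab, rfl | ha, rfl | hb⟩
      · exact absurd rfl hab.ne
      · exact Or.inr (Or.inr ⟨rfl, huniq b hb hab.symm⟩)
      · exact Or.inr (Or.inl ⟨huniq a ha hab, rfl⟩)
      · exact Or.inl ⟨hab, ha, hb⟩

theorem exists_isPath_in_subgraph (H : T.Subgraph) (hH : H.coe.Connected) {a b : V}
    (ha : a ∈ H.verts) (hb : b ∈ H.verts) :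
    ∃ p : T.Walk a b, p.IsPath ∧ ∀ x y, s(x, y) ∈ p.edges → H.Adj x y := by
  classical
  obtain ⟨w⟩ := hH.preconnected ⟨a, ha⟩ ⟨b, hb⟩
  refine ⟨(w.map H.hom).bypass, SimpleGraph.Walk.bypass_isPath _, fun x y h => ?_⟩
  have hmem : s(x, y) ∈ w.edges.map (Sym2.map H.hom) := by
    rw [← SimpleGraph.Walk.edges_map]
    exact SimpleGraph.Walk.edges_bypass_subset_edges _ h
  obtain ⟨e, he, hxy⟩ := List.mem_map.1 hmem
  induction e using Sym2.ind with
  | _ c d =>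
    have hcd : H.Adj c d := w.adj_of_mem_edges he
    rw [Sym2.map_mk, Sym2.eq_iff] at hxy
    rcases hxy with ⟨rfl, rfl⟩ | ⟨rfl, rfl⟩
    · exact hcd
    · exact hcd.symm

theorem isPath_unique (hT : T.IsAcyclic) {a b : V} {p q : T.Walk a b} (hp : p.IsPath)
    (hq : q.IsPath) : p = q :=
  Subtype.mk.inj ((hT.subsingleton_path a b).elim ⟨p, hp⟩ ⟨q, hq⟩)

/-- A subtree through a vertex `u` of `D` that has an edge inside `D` has such an edge at `u`. -/
theorem exists_adj_mem_of_adj (hT : T.IsAcyclic) {D : Set V} (hD : PathConnected T D)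
    (H : T.Subgraph) (hH : H.coe.Connected) {u c d : V} (hu : u ∈ D) (huH : u ∈ H.verts)
    (hcd : H.Adj c d) (hc : c ∈ D) (hd : d ∈ D) : ∃ w ∈ D, H.Adj u w := by
  obtain ⟨p, hp, hpH⟩ := exists_isPath_in_subgraph H hH huH (H.edge_vert hcd)
  obtain ⟨q, hq, hqD⟩ := hD u hu c hc
  -- The path from $u$ to $c$ in `H` is also the one inside `D`, so its first edge has both
  -- properties.
  obtain rfl := isPath_unique hT hp hq
  cases p with
  | nil => exact ⟨d, hd, hcd⟩
  | @cons _ y _ h p => exact ⟨y, hqD y (by simp), hpH u y (by simp)⟩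

/-- If a subtree through the vertex `u` of `D` without an edge inside `D` has an edge in common with
a subtree that has an edge inside `D`, then both have an edge at `u` in common. -/
theorem exists_common_adj (hT : T.IsAcyclic) {D : Set V} (hD : PathConnected T D)
    (H K : T.Subgraph) (hH : H.coe.Connected) (hK : K.coe.Connected) {u a b c d : V} (hu : u ∈ D)
    (huH : u ∈ H.verts) (hHD : ∀ x ∈ D, ∀ y ∈ D, ¬ H.Adj x y) (hab : H.Adj a b) (hab' : K.Adj a b)
    (hcd : K.Adj c d) (hc : c ∈ D) : ∃ y, H.Adj u y ∧ K.Adj u y := by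
  obtain ⟨p, hp, hpH⟩ := exists_isPath_in_subgraph H hH huH (H.edge_vert hab)
  obtain ⟨q, hq, hqD⟩ := hD c hc u hu
  obtain ⟨k, hk, hkK⟩ := exists_isPath_in_subgraph K hK (K.edge_vert hcd) (K.edge_vert hab')
  -- The two paths share no edge because `H` has none inside `D`, and in a forest a trail is a path.
  -- By uniqueness it is the path from $c$ to $a$ in `K`, so `K` contains the part `p` that starts
  -- at $u$.
  have hqp : (q.append p).IsPath := by
    rw [hT.isPath_iff_isTrail, SimpleGraph.Walk.isTrail_def, SimpleGraph.Walk.edges_append,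
      List.nodup_append']
    refine ⟨hq.isTrail.edges_nodup, hp.isTrail.edges_nodup, fun e he he' => ?_⟩
    induction e using Sym2.ind with
    | _ x y =>
      exact hHD x (hqD x (q.fst_mem_support_of_mem_edges he)) y
        (hqD y (q.snd_mem_support_of_mem_edges he)) (hpH x y he')
  have hpk : ∀ x y, s(x, y) ∈ p.edges → K.Adj x y := fun x y h => hkK x y (by
    rw [isPath_unique hT hk hqp, SimpleGraph.Walk.edges_append]
    exact List.mem_append_right _ h)
  cases p with
  | nil => exact ⟨b, hab, hab'⟩
  | @cons _ y _ h p => exact ⟨y, hpH u y (by simp), hpk u y (by simp)⟩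

/-! ### The invariant of the algorithm -/

theorem card_filter_le_two_of_present {γ : Type*} [DecidableEq γ]
    {R : ι → RootedSubtree T} (o : ι → γ)
    (ho : ∀ i j, i ≠ j → o i = o j → ¬ Collide (R i) (R j)) {a b : V} {S : Finset ι}
    (hS : ∀ i ∈ S, Present (R i) a b) (c : γ) : (S.filter fun i => o i = c).card ≤ 2 := by
  by_contra h
  obtain ⟨i, j, l, hi, hj, hl, hij, hil, hjl⟩ := Finset.two_lt_card_iff.1 (not_le.1 h)
  rw [Finset.mem_filter] at hi hj hl
  rcases collide_or_collide_of_present (hS i hi.1) (hS j hj.1) (hS l hl.1) with h | h | h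
  · exact ho i j hij (hi.2.trans hj.2.symm) h
  · exact ho i l hil (hi.2.trans hl.2.symm) h
  · exact ho j l hjl (hj.2.trans hl.2.symm) h

theorem card_le_of_present {γ : Type*} [DecidableEq γ] [Fintype γ]
    {R : ι → RootedSubtree T} (o : ι → γ)
    (ho : ∀ i j, i ≠ j → o i = o j → ¬ Collide (R i) (R j)) {a b : V} {S : Finset ι}
    (hS : ∀ i ∈ S, Present (R i) a b) : S.card ≤ 2 * Fintype.card γ :=
  (Finset.card_le_mul_card_image_of_maps_to (f := o) (t := Finset.univ)
    (fun _ _ => Finset.mem_univ _) 2 fun c _ => card_filter_le_two_of_present o ho hS c)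

/-- The colors $0,\dots,m$ are $m+1$ values on `X`, whence the strict inequality. -/
theorem lt_card_image_of_forall_exists {φ : ι → Option ℕ} {X : Finset ι} {m : ℕ}
    (h : ∀ c ≤ m, ∃ j ∈ X, φ j = some c) : m < (X.image φ).card := by
  have : (Finset.range (m + 1)).image some ⊆ X.image φ := by
    intro c hc
    obtain ⟨n, hn, rfl⟩ := Finset.mem_image.1 hc
    obtain ⟨j, hj, hjn⟩ := h n (Nat.lt_succ_iff.1 (Finset.mem_range.1 hn))
    exact Finset.mem_image.2 ⟨j, hj, hjn⟩
  have := Finset.card_le_card this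
  rw [Finset.card_image_of_injective _ (Option.some_injective ℕ), Finset.card_range] at this
  exact this

/-- In an initial segment the largest color, if any, is one less than the number of colors. This
links bounds on single colors to the color counts that a type 4 round compares. -/
theorem IsInitial.forall_lt_iff [Finite ι] {φ : ι → Option ℕ} (h : IsInitial φ) (N : ℕ) :
    (∀ i m, φ i = some m → m < N) ↔ numColors φ ≤ N := by
  constructor
  · intro hN
    have : {c : ℕ | ∃ i, φ i = some c} ⊆ (Finset.range N : Set ℕ) := by
      rintro c ⟨i, hi⟩
      simpa using hN i c hi
    simpa [numColors] using Set.ncard_le_ncard this (Finset.finite_toSet _)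
  · intro hN i m hi
    have hfin : (some ⁻¹' Set.range φ).Finite :=
      (Set.finite_range φ).preimage (Option.some_injective ℕ).injOn
    have : (Finset.range (m + 1) : Set ℕ) ⊆ {c : ℕ | ∃ i, φ i = some c} := by
      intro c hc
      exact h i m hi c (Nat.lt_succ_iff.1 (by simpa using hc))
    have := Set.ncard_le_ncard this hfin
    rw [Set.ncard_coe_finset, Finset.card_range] at this
    exact lt_of_lt_of_le this hN

/-- The invariant of GREEDY-COL: the members colored are those present on a processed edge, and the
coloring is valid and uses an initial segment of the colors below `N`. -/
structure IsState (R : ι → RootedSubtree T) (N : ℕ) (es : List (V × V)) (φ : ι → Option ℕ) :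
    Prop where
  ne_none_iff : ∀ i, φ i ≠ none ↔ ∃ a b, Processed es a b ∧ Present (R i) a b
  valid : IsValid R φ
  initial : IsInitial φ
  bound : ∀ i m, φ i = some m → m < N

theorem IsState.snoc {R : ι → RootedSubtree T} {N : ℕ} {es : List (V × V)} {φ φ' : ι → Option ℕ}
    (h : IsState R N es φ) {u v : V} (hv : IsValid R φ') (hin : IsInitial φ')
    (hφ' : ∀ i, φ' i ≠ none ↔ φ i ≠ none ∨ i ∈ uncolored R φ u v)
    (hN : ∀ i m, φ' i = some m → m < N) : IsState R N (es ++ [(u, v)]) φ' := by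
  refine ⟨fun i => ?_, hv, hin, hN⟩
  rw [hφ']
  have e : ∀ a b, Processed (es ++ [(u, v)]) a b ↔
      Processed es a b ∨ (a = u ∧ b = v) ∨ (a = v ∧ b = u) := by
    intro a b
    simp only [Processed, List.mem_append, List.mem_singleton, Prod.mk.injEq]
    tauto
  constructor
  · rintro (hi | hi)
    · obtain ⟨a, b, hab, hp⟩ := (h.ne_none_iff i).1 hi
      exact ⟨a, b, (e a b).2 (Or.inl hab), hp⟩
    · exact ⟨u, v, (e u v).2 (Or.inr (Or.inl ⟨rfl, rfl⟩)), hi.1⟩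
  · rintro ⟨a, b, hab, hp⟩
    by_cases hi : φ i = none
    · right
      rcases (e a b).1 hab with h' | ⟨rfl, rfl⟩ | ⟨rfl, rfl⟩
      · exact absurd hi ((h.ne_none_iff i).2 ⟨a, b, h', hp⟩)
      · exact ⟨hp, hi⟩
      · exact ⟨hp.symm, hi⟩
    · exact Or.inl hi

theorem present_iff {A : RootedSubtree T} {a b : V} : Present A a b ↔ A.skeleton.Adj a b :=
  (A.skeleton_adj a b).symm

/-! ### Where members meet around the current vertex -/

section Search

variable {R : ι → RootedSubtree T} {N : ℕ} {es : List (V × V)} {φ : ι → Option ℕ} {D : Set V}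

/-- A colored member through a discovered vertex `u` is present on a processed edge at `u`. -/
theorem IsState.exists_present (h : IsState R N es φ) (hT : T.IsAcyclic) (hD : Reach T es D)
    {u y : V} (hu : u ∈ D) {j : ι} (hj : φ j ≠ none) (hjy : Present (R j) u y) :
    ∃ w ∈ D, T.Adj u w ∧ Present (R j) u w := by
  obtain ⟨a, b, hab, hp⟩ := (h.ne_none_iff j).1 hj
  rw [hD.processed_iff hT] at hab
  obtain ⟨w, hw, hadj⟩ := exists_adj_mem_of_adj hT hD.pathConnected (R j).skeleton
    (R j).isTree.connected hu ((R j).skeleton.edge_vert (present_iff.1 hjy)) (present_iff.1 hp)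
    hab.2.1 hab.2.2
  exact ⟨w, hw, hadj.adj_sub, present_iff.2 hadj⟩

/-- An uncolored member through a discovered vertex `u` meets every colored member with which it
collides on an unprocessed edge at `u`. -/
theorem IsState.exists_common_present (h : IsState R N es φ) (hT : T.IsAcyclic)
    (hD : Reach T es D) {u v : V} (hu : u ∈ D) {i j : ι} (hi : φ i = none)
    (hiv : Present (R i) u v) (hj : φ j ≠ none) (hij : Collide (R i) (R j)) :
    ∃ y, y ∉ D ∧ T.Adj u y ∧ Present (R i) u y ∧ Present (R j) u y := by
  obtain ⟨c, d, hcd, hp⟩ := (h.ne_none_iff j).1 hj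
  rw [hD.processed_iff hT] at hcd
  obtain ⟨a, b, h1, h2⟩ := hij
  have hiD : ∀ x ∈ D, ∀ y ∈ D, ¬ (R i).skeleton.Adj x y := fun x hx y hy hxy =>
    (h.ne_none_iff i).2 ⟨x, y, (hD.processed_iff hT x y).2 ⟨hxy.adj_sub, hx, hy⟩,
      present_iff.2 hxy⟩ hi
  obtain ⟨y, hy, hy'⟩ := exists_common_adj hT hD.pathConnected (R i).skeleton (R j).skeleton
    (R i).isTree.connected (R j).isTree.connected hu
    ((R i).skeleton.edge_vert (present_iff.1 hiv)) hiD (present_iff.1 (Or.inl h1))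
    (present_iff.1 (Or.inl h2)) (present_iff.1 hp) hcd.2.1
  exact ⟨y, fun hyD => hiD u hu y hyD hy, hy.adj_sub, present_iff.2 hy, present_iff.2 hy'⟩

/-- Away from type 4, colored and uncolored members meet on the current edge only. -/
theorem IsState.present_of_not_isType4 [Fintype V] [DecidableRel T.Adj] (h : IsState R N es φ)
    (hT : T.IsAcyclic) (hD : Reach T es D) {u v : V} (hdeg : T.degree u ≤ 3) (huv : T.Adj u v)
    (hu : u ∈ D) (hv : v ∉ D) (h4 : ¬ ∃ w x, IsType4 T es u v w x) {i j : ι} (hi : φ i = none)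
    (hiv : Present (R i) u v) (hj : φ j ≠ none) (hij : Collide (R i) (R j)) :
    Present (R j) u v := by
  classical
  obtain ⟨y, hyD, huy, -, hjy⟩ := h.exists_common_present hT hD hu hi hiv hj hij
  obtain ⟨w, hwD, huw, -⟩ := h.exists_present hT hD hu hj hjy
  by_cases hyv : y = v
  · exact hyv ▸ hjy
  -- Otherwise $v,w,y$ are three distinct neighbours of $u$, hence all of them, and the edge is of
  -- type 4.
  have hvw : v ≠ w := fun h => hv (h ▸ hwD)
  have hwy : w ≠ y := fun h => hyD (h ▸ hwD)
  have hsub : ({v, w, y} : Finset V) ⊆ T.neighborFinset u := by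
    intro z hz
    simp only [Finset.mem_insert, Finset.mem_singleton] at hz
    rw [SimpleGraph.mem_neighborFinset]
    rcases hz with rfl | rfl | rfl
    exacts [huv, huw, huy]
  have hcard : ({v, w, y} : Finset V).card = 3 :=
    Finset.card_eq_three.2 ⟨v, w, y, hvw, Ne.symm hyv, hwy, rfl⟩
  have heq := Finset.eq_of_subset_of_card_le hsub (by rw [hcard]; exact hdeg)
  refine absurd ⟨w, y, hvw, Ne.symm hyv, hwy, fun z => ?_, ?_, ?_⟩ h4
  · rw [← SimpleGraph.mem_neighborFinset, ← heq]
    simp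
  · exact (hD.processed_iff hT u w).2 ⟨huw, hu, hwD⟩
  · exact fun h => hyD ((hD.processed_iff hT u y).1 h).2.2

end Search

/-- A round that is not of type 4 preserves the invariant. -/
theorem IsState.firstFit [Fintype ι] [DecidableEq ι] {R : ι → RootedSubtree T}
    {γ : Type*} [Fintype γ] [DecidableEq γ] {o : ι → γ}
    (ho : ∀ i j, i ≠ j → o i = o j → ¬ Collide (R i) (R j)) {N : ℕ}
    (hN : 2 * Fintype.card γ ≤ N) {es : List (V × V)} {φ φ' : ι → Option ℕ}
    (h : IsState R N es φ) {u v : V}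
    (hcol : ∀ i j, φ i = none → Present (R i) u v → φ j ≠ none → Collide (R i) (R j) →
      Present (R j) u v) (hφ : FirstFit R (uncolored R φ u v) φ φ') :
    IsState R N (es ++ [(u, v)]) φ' := by
  classical
  set X : Finset ι := Finset.univ.filter fun i => Present (R i) u v
  have hX : ∀ i, i ∈ X ↔ Present (R i) u v := fun i => by simp [X]
  have K := hφ.fitSpec (X := X) fun r hr hr' => ⟨(hX r).2 hr.1, fun j hj hj' => (hX j).2 (by
    rcases hj' with hj' | hj'
    · exact hcol r j hr' hr.1 hj' hj
    · exact hj'.1)⟩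
  refine h.snoc (K.valid h.valid) (K.initial h.initial) K.ne_none_iff fun i m hi => ?_
  by_cases hφi : φ i = none
  · exact ((lt_card_image_of_forall_exists (K.bound i m hφi hi)).trans_le
      (Finset.card_image_le.trans (card_le_of_present o ho fun i hi => (hX i).1 hi))).trans_le hN
  · exact h.bound i m (K.ext i hφi ▸ hi)

/-- A round of type 4 preserves the invariant. -/
theorem IsState.process [Fintype ι] [DecidableEq ι] {R : ι → RootedSubtree T}
    {γ : Type*} [Fintype γ] [DecidableEq γ] {o : ι → γ}
    (ho : ∀ i j, i ≠ j → o i = o j → ¬ Collide (R i) (R j)) {es : List (V × V)}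
    {φ φ₁ φ₂ : ι → Option ℕ} (h : IsState R (5 * Fintype.card γ / 2) es φ) {u v w x : V}
    (hw : ∀ j, φ j ≠ none → Present (R j) u v ∨ Present (R j) u x → Present (R j) u w)
    (hcol : ∀ i j, φ i = none → Present (R i) u v → φ j ≠ none → Collide (R i) (R j) →
      Present (R j) u v ∨ Present (R i) u x ∧ Present (R j) u x)
    (h₁ : ProcessEdge1 R u v φ φ₁) (h₂ : ProcessEdge2 R u v x φ φ₂) :
    IsState R (5 * Fintype.card γ / 2) (es ++ [(u, v)])
      (if numColors φ₁ ≤ numColors φ₂ then φ₁ else φ₂) := by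
  classical
  set N := 5 * Fintype.card γ / 2
  set A : Finset ι := Finset.univ.filter fun i => Present (R i) u v ∧ φ i ≠ none
  set B : Finset ι := Finset.univ.filter fun i =>
    Present (R i) u x ∧ φ i ≠ none ∧ ¬ Present (R i) u v
  set X : Finset ι := Finset.univ.filter fun i =>
    Present (R i) u v ∧ φ i = none ∧ Present (R i) u x
  set Y : Finset ι := Finset.univ.filter fun i =>
    Present (R i) u v ∧ φ i = none ∧ ¬ Present (R i) u x
  set Z : Finset ι := Finset.univ.filter fun i => Present (R i) u v
  have mA : ∀ i, i ∈ A ↔ Present (R i) u v ∧ φ i ≠ none := fun i => by simp [A]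
  have mB : ∀ i, i ∈ B ↔ Present (R i) u x ∧ φ i ≠ none ∧ ¬ Present (R i) u v :=
    fun i => by simp [B]
  have mX : ∀ i, i ∈ X ↔ Present (R i) u v ∧ φ i = none ∧ Present (R i) u x :=
    fun i => by simp [X]
  have mY : ∀ i, i ∈ Y ↔ Present (R i) u v ∧ φ i = none ∧ ¬ Present (R i) u x :=
    fun i => by simp [Y]
  have mZ : ∀ i, i ∈ Z ↔ Present (R i) u v := fun i => by simp [Z]
  clear_value A B X Y Z
  obtain ⟨M₁, ψ₁, hM₁, hT₁, hF₁⟩ := h₁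
  obtain ⟨M₂, ψ₂, χ, hM₂, hT₂, hF₂, hFF⟩ := h₂
  obtain ⟨ext₁, nn₁, val₁, ini₁, pair₁, bd₁⟩ := matchedFit_transfer_spec hM₁.1 hT₁ hF₁
    (fun i => by
      simp only [colored, uncolored, Set.mem_union, Set.mem_ofPred_eq]; tauto)
    h.valid h.initial (a := u) (b := v)
    (fun i hi => by
      simp only [colored, uncolored, Set.mem_union, Set.mem_ofPred_eq] at hi
      exact hi.elim (fun h => h.1) fun h => h.1)
    (X := A ∪ B ∪ (X ∪ Y))
    (fun i hi => by
      have : Present (R i) u v ∧ φ i = none := hi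
      simp only [Finset.mem_union, mX, mY]; tauto)
    (fun i hi j hj hij => by
      have := hcol i j hi.2 hi.1 hj hij
      simp only [Finset.mem_union, mA, mB]; tauto)
  obtain ⟨ext₂, nn₂, val₂, ini₂, pair₂, bd₂⟩ := matchedFit_transfer_spec hM₂.1 hT₂ hF₂
    (fun i => by
      simp only [colored, uncolored, Set.mem_union, Set.mem_ofPred_eq, Set.mem_sdiff]; tauto)
    h.valid h.initial (a := u) (b := x)
    (fun i hi => by
      simp only [colored, uncolored, Set.mem_union, Set.mem_ofPred_eq, Set.mem_sdiff] at hi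
      exact hi.elim (fun h => h.1.1) fun h => h.2)
    (X := A ∪ B ∪ X)
    (fun i hi => by
      simp only [uncolored, Set.mem_ofPred_eq] at hi
      simp only [Finset.mem_union, mX]; tauto)
    (fun i hi j hj hij => by
      simp only [uncolored, Set.mem_ofPred_eq] at hi
      have := hcol i j hi.1.2 hi.1.1 hj hij
      simp only [Finset.mem_union, mA, mB]; tauto)
  have count := card_image_add_card_image_le R φ o ho (A := A) (B := B) (X := X) (Y := Y)
    (fun i hi => ((mA i).1 hi).2) (fun i hi => ((mB i).1 hi).2.1) (fun i hi => ((mX i).1 hi).2.1)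
    (fun i hi => ((mY i).1 hi).2.1)
    (Finset.disjoint_left.2 fun i hi hi' => ((mB i).1 hi').2.2 ((mA i).1 hi).1)
    (Finset.disjoint_left.2 fun i hi hi' => ((mY i).1 hi').2.2 ((mX i).1 hi).2.2)
    (fun i hi j hj hij => by
      have hi' := (mX i).1 hi
      have := hcol i j hi'.2.1 hi'.1 hj hij
      simp only [Finset.mem_union, mA, mB]; tauto)
    (card_filter_le_two_of_present o ho (a := u) (b := w) fun i hi => by
      simp only [Finset.mem_union, mA, mB] at hi
      exact hw i (by tauto) (by tauto))
    (card_filter_le_two_of_present o ho (a := u) (b := x) fun i hi => by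
      simp only [Finset.mem_union, mX, mB] at hi
      exact hi.elim (fun h => h.1) fun h => h.2.2)
    (card_filter_le_two_of_present o ho (a := u) (b := v) fun i hi => by
      simp only [Finset.mem_union, mX, mY, mA] at hi
      rcases hi with h | h | h <;> exact h.1)
    (fun i => by
      simp only [colored, uncolored, Set.mem_union, Set.mem_ofPred_eq, Finset.mem_union, mA, mX, mY]
      tauto)
    (fun i => by
      simp only [colored, uncolored, Set.mem_union, Set.mem_ofPred_eq, Set.mem_sdiff,
        Finset.mem_union, mB, mX]
      tauto)
    hM₁ hM₂ ext₁ ext₂ pair₁ pair₂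
  -- The matched phase has colored all of $X$, so the members left are not on $\{u,x\}$ and all
  -- their relevant collisions are with members on $\{u,v\}$.
  have K := hFF.fitSpec (X := Z) fun r hr hr' => ⟨(mZ r).2 hr.1, fun j hj hj' => (mZ j).2 (by
    have hrx : ¬ Present (R r) u x := fun hrx => (nn₂ r).2 (Or.inr ⟨hr, hrx⟩) hr'
    have hS : j ∈ uncolored R φ u v → Present (R j) u v := fun h => h.1
    by_cases hφj : φ j = none
    · rcases hj' with hj' | hj'
      · rcases (nn₂ j).1 hj' with h' | h'
        · exact absurd hφj h'
        · exact hS h'.1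
      · exact hS hj'
    · exact (hcol r j hr.2 hr.1 hφj hj).resolve_right fun h => hrx h.1)⟩
  have hZc : Z.card ≤ 2 * Fintype.card γ := card_le_of_present o ho fun i hi => (mZ i).1 hi
  have nn₃ : ∀ i, φ₂ i ≠ none ↔ φ i ≠ none ∨ i ∈ uncolored R φ u v := fun i => by
    rw [K.ne_none_iff, nn₂]
    simp only [Set.mem_ofPred_eq]
    tauto
  -- A color is either an old one, below `N`, or one up to which all colors occur on $A\cup B\cup
  -- X\cup Y$.
  have big₁ : ∀ i m, φ₁ i = some m → m < max N ((A ∪ B ∪ (X ∪ Y)).image φ₁).card := by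
    intro i m hi
    rcases bd₁ i m hi with ⟨s, hs⟩ | h'
    · exact lt_max_of_lt_left (h.bound s m hs)
    · exact lt_max_of_lt_right (lt_card_image_of_forall_exists h')
  have big₂ : ∀ i m, φ₂ i = some m → m < max N ((A ∪ B ∪ X).image χ).card := by
    intro i m hi
    by_cases hχ : χ i = none
    · refine lt_max_of_lt_left ?_
      have := (lt_card_image_of_forall_exists (K.bound i m hχ hi)).trans_le
        (Finset.card_image_le.trans hZc)
      omega
    · rcases bd₂ i m (K.ext i hχ ▸ hi) with ⟨s, hs⟩ | h'
      · exact lt_max_of_lt_left (h.bound s m hs)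
      · exact lt_max_of_lt_right (lt_card_image_of_forall_exists h')
  have n₁ := (ini₁.forall_lt_iff _).1 big₁
  have n₂ := ((K.initial ini₂).forall_lt_iff _).1 big₂
  -- By `count` one of the two image sizes is at most `N`, so one result uses at most `N` colors,
  -- and the result kept uses no more than that one.
  split_ifs with hle
  · exact h.snoc val₁ ini₁ nn₁ ((ini₁.forall_lt_iff _).2 (by omega))
  · exact h.snoc (K.valid val₂) (K.initial ini₂) nn₃
      (((K.initial ini₂).forall_lt_iff _).2 (by omega))

theorem GreedyColRun.isState [Fintype V] [Fintype ι] [DecidableEq ι] [DecidableRel T.Adj]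
    (hT : T.IsAcyclic) (hdeg : ∀ v, T.degree v ≤ 3) {R : ι → RootedSubtree T}
    {γ : Type*} [Fintype γ] [DecidableEq γ] {o : ι → γ}
    (ho : ∀ i j, i ≠ j → o i = o j → ¬ Collide (R i) (R j)) {es : List (V × V)}
    {φ : ι → Option ℕ} (h : GreedyColRun R es φ) {D : Set V} (hD : Reach T es D) :
    IsState R (5 * Fintype.card γ / 2) es φ := by
  induction h generalizing D with
  | nil =>
    refine ⟨fun i => ⟨fun h => absurd rfl h, ?_⟩, ?_, ?_, ?_⟩
    · rintro ⟨a, b, hab | hab, _⟩ <;> simp at hab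
    · intro i j c _ hi; cases hi
    · intro i m hi; cases hi
    · intro i m hi; cases hi
  | snoc es u v φ φ' _ hr ih =>
    obtain ⟨D₀, hD₀, huv, hu, hv, -⟩ := hD.of_snoc
    have hst := ih hD₀
    rcases hr with ⟨w, x, ⟨-, -, -, hnb, hw, hx⟩, φ₁, φ₂, h₁, h₂, rfl⟩ | ⟨h4, hff⟩
    · have hwD : w ∈ D₀ := ((hD₀.processed_iff hT u w).1 hw).2.2
      have hxD : x ∉ D₀ := fun h =>
        hx ((hD₀.processed_iff hT u x).2 ⟨(hnb x).2 (Or.inr (Or.inr rfl)), hu, h⟩)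
      -- Since $w$ is the only discovered neighbour of $u$, the colored members through $u$ are
      -- present on $\{u,w\}$, while new members meet old ones on $\{u,v\}$ or $\{u,x\}$.
      refine hst.process ho (w := w) (x := x) (fun j hj hp => ?_) (fun i j hi hiv hj hij => ?_) h₁ h₂
      · obtain ⟨y, hy⟩ : ∃ y, Present (R j) u y := hp.elim (fun h => ⟨v, h⟩) fun h => ⟨x, h⟩
        obtain ⟨z, hzD, huz, hz⟩ := hst.exists_present hT hD₀ hu hj hy
        rcases (hnb z).1 huz with rfl | rfl | rfl
        exacts [absurd hzD hv, hz, absurd hzD hxD]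
      · obtain ⟨y, hyD, huy, hiy, hjy⟩ := hst.exists_common_present hT hD₀ hu hi hiv hj hij
        rcases (hnb y).1 huy with rfl | rfl | rfl
        exacts [Or.inl hjy, absurd hwD hyD, Or.inr ⟨hiy, hjy⟩]
    · exact hst.firstFit ho (by omega) (fun i j hi hiv hj hij =>
        hst.present_of_not_isType4 hT hD₀ (hdeg u) huv hu hv h4 hi hiv hj hij) hff

/-! ### Executability of rounds and completeness of the search -/

theorem exists_round [Finite ι] [DecidableEq ι] (R : ι → RootedSubtree T) (es : List (V × V))
    (u v : V) (φ : ι → Option ℕ) : ∃ φ', Round R es u v φ φ' := by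
  by_cases h4 : ∃ w x, IsType4 T es u v w x
  · obtain ⟨w, x, h4⟩ := h4
    obtain ⟨M₁, hM₁⟩ := exists_isMaximumMatching
      (shareGraph R φ (colored R φ u v ∪ uncolored R φ u v))
    obtain ⟨ψ₁, hψ₁⟩ := exists_transfer hM₁.1 φ
    obtain ⟨φ₁, hφ₁⟩ := exists_matchedFit R M₁ (uncolored R φ u v) ψ₁
    obtain ⟨M₂, hM₂⟩ := exists_isMaximumMatching
      (shareGraph R φ ((colored R φ u x \ colored R φ u v) ∪
        {i ∈ uncolored R φ u v | Present (R i) u x}))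
    obtain ⟨ψ₂, hψ₂⟩ := exists_transfer hM₂.1 φ
    obtain ⟨χ, hχ⟩ := exists_matchedFit R M₂ {i ∈ uncolored R φ u v | Present (R i) u x} ψ₂
    obtain ⟨φ₂, hφ₂⟩ := exists_firstFit R (uncolored R φ u v) χ
    exact ⟨_, Or.inl ⟨w, x, h4, φ₁, φ₂, ⟨M₁, ψ₁, hM₁, hψ₁, hφ₁⟩,
      ⟨M₂, ψ₂, χ, hM₂, hψ₂, hχ, hφ₂⟩, rfl⟩⟩
  · obtain ⟨φ', hφ'⟩ := exists_firstFit R (uncolored R φ u v) φ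
    exact ⟨φ', Or.inr ⟨h4, hφ'⟩⟩

theorem IsBFSOrder.exists_reach_univ (hT : T.Connected) {es : List (V × V)}
    (h : IsBFSOrder T es) : Reach T es Set.univ := by
  obtain ⟨r, hr⟩ := h
  obtain ⟨D, hD, hcl⟩ := hr.reach (es₀ := []) (by simp) (Reach.nil r) (by simp)
  rw [List.nil_append] at hD
  obtain ⟨a, ha⟩ : ∃ a, a ∈ D := by
    cases hD with
    | nil r => exact ⟨r, rfl⟩
    | snoc es D u v => exact ⟨v, Or.inl rfl⟩
  have : D = Set.univ := by
    refine Set.eq_univ_of_forall fun b => ?_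
    obtain ⟨p⟩ := hT.preconnected a b
    induction p with
    | nil => exact ha
    | cons hadj _ ih => exact ih (hcl _ ha _ hadj)
  exact this ▸ hD

end GreedyCol

theorem theorem1 {V ι : Type*} [Fintype V] [Fintype ι] [DecidableEq ι]
    (T : SimpleGraph V) [DecidableRel T.Adj] (hT : T.IsTree) (hdeg : ∀ v, T.degree v ≤ 3)
    (R : ι → GreedyCol.RootedSubtree T) (hR : ∀ i, ∃ a b, (R i).arc a b) :
    (∃ es, GreedyCol.IsBFSOrder T es) ∧
    ∀ es, GreedyCol.IsBFSOrder T es →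
      -- the algorithm never gets stuck: whatever was chosen so far, the next round can be executed
      (∀ es₁ u v es₂ φ, es = es₁ ++ (u, v) :: es₂ → GreedyCol.GreedyColRun R es₁ φ →
        ∃ φ', GreedyCol.Round R es₁ u v φ φ') ∧
      -- every complete run outputs a valid coloring with at most `5/2` times the optimum
      ∀ φ, GreedyCol.GreedyColRun R es φ →
        ∃ ψ : (GreedyCol.conflictGraph R).Coloring ℕ, (∀ i, φ i = some (ψ i)) ∧
          ∃ k : ℕ, (GreedyCol.conflictGraph R).chromaticNumber = k ∧
            ((Set.range ψ).ncard : ℝ) ≤ 5 / 2 * k := by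
  obtain ⟨r⟩ := hT.connected.nonempty
  refine ⟨(GreedyCol.exists_bfsFrom T [r] {r}).imp fun es h => ⟨r, h⟩, fun es hes =>
    ⟨fun es₁ u v _ φ _ _ => GreedyCol.exists_round R es₁ u v φ, fun φ hφ => ?_⟩⟩
  have hreach := hes.exists_reach_univ hT.connected
  obtain ⟨k, hk⟩ := ENat.ne_top_iff_exists.1
    (SimpleGraph.chromaticNumber_ne_top_iff_exists.2
      ⟨_, (GreedyCol.conflictGraph R).colorable_of_fintype⟩)
  obtain ⟨o⟩ : (GreedyCol.conflictGraph R).Colorable k :=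
    SimpleGraph.chromaticNumber_le_iff_colorable.1 hk.symm.le
  have hst := hφ.isState hT.isAcyclic hdeg (o := o)
    (fun i j hij h hc => o.valid (v := i) (w := j) ⟨hij, hc⟩ h) hreach
  rw [Fintype.card_fin] at hst
  -- Every member has an edge, and by the end all edges of the tree are processed.
  have hcol : ∀ i, φ i ≠ none := fun i => by
    obtain ⟨a, b, hab⟩ := hR i
    exact (hst.ne_none_iff i).2 ⟨a, b, (hreach.processed_iff hT.isAcyclic a b).2
      ⟨(GreedyCol.present_iff.1 (Or.inl hab)).adj_sub, trivial, trivial⟩, Or.inl hab⟩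
  choose f hf using fun i => Option.ne_none_iff_exists'.1 (hcol i)
  refine ⟨SimpleGraph.Coloring.mk f fun {i j} hij h =>
    hst.valid i j (f i) hij.1 (hf i) (h ▸ hf j) hij.2, hf, k, hk.symm, ?_⟩
  have hset : Set.range f = {c | ∃ i, φ i = some c} := by
    ext c
    simp [hf]
  have hN : (Set.range f).ncard ≤ 5 * k / 2 := by
    rw [hset]
    exact (hst.initial.forall_lt_iff _).1 hst.bound
  have h2 : 2 * (Set.range f).ncard ≤ 5 * k := by omega
  have h3 : 2 * ((Set.range f).ncard : ℝ) ≤ 5 * k := by exact_mod_cast h2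
  change ((Set.range f).ncard : ℝ) ≤ 5 / 2 * k
  linarith
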